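/- Let $n\in\mathbb N$, $a<b$, let $\mathcal J=\begin{pmatrix}0&I\\-I&0\end{pmatrix}\in\mathbb R^{2n\times 2n}$, and let $E=\begin{pmatrix}0\\I\end{pmatrix}\in\mathbb R^{2n\times n}$ be the vertical Lagrangian plane. A continuous Lagrangian path on $[a,b]$ is a continuous function $Y=\begin{pmatrix}X\\U\end{pmatrix}:[a,b]\to\mathbb R^{2n\times n}$ with $Y(t)^T\mathcal J\,Y(t)=0$ and $\operatorname{rank}Y(t)=n$ for all $t\in[a,b]$. Comparative index. For $Y=\begin{pmatrix}X\\U\end{pmatrix}$, $\hat Y=\begin{pmatrix}\hat X\\\hat U\end{pmatrix}\in\mathbb R^{2n\times n}$ with $Y^T\mathcal JY=0=\hat Y^T\mathcal J\hat Y$ and $\operatorname{rank}Y=n=\operatorname{rank}\hat Y$ put $W=Y^T\mathcal J\hat Y$, $\mathcal M=(I-X^\dagger X)W$, $V=I-\mathcal M^\dagger\mathcal M$, $\mathcal P=V\,W^TX^\dagger\hat X\,V$, where $\dagger$ is the Moore–Penrose pseudoinverse, and $\mu(Y,\hat Y)=\operatorname{rank}\mathcal M+\operatorname{ind}\mathcal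 P$, where $\operatorname{ind}\mathcal P$ is the number of negative eigenvalues of $\mathcal P$, counted with multiplicity. Maslov index. For continuous Lagrangian paths $Y,\hat Y$ on $[a,b]$ let $$\Gamma(t)=-[X(t)+iU(t)]\,[X(t)-iU(t)]^{-1}\,[\hat X(t)-i\hat U(t)]\,[\hat X(t)+i\hat U(t)]^{-1}.$$ Choose a partition $a=t_0<t_1<\dots<t_p=b$ and numbers $\varepsilon_k\in(0,\pi)$ such that $\Gamma(t)-e^{i(\pi\pm\varepsilon_k)}I$ is invertible for all $t\in[t_{k-1},t_k]$, $k=1,\dots,p$; put $\ell(t,\varepsilon_k)=\sum_{\theta\in[0,\varepsilon_k)}\dim\ker\big(\Gamma(t)-e^{i(\pi+\theta)}I\big)$ and $$\operatorname{Mas}(Y,\hat Y)=\sum_{k=1}^p\big(\ell(t_k,\varepsilon_k)-\ell(t_{k-1},\varepsilon_k)\big).$$ Corollary. Let $Y$ and $\hat Y$ be continuous Lagrangian paths on $[a,b]$. Then the Maslov indices $\operatorname{Mas}(Y,\hat Y)$, $\operatorname{Mas}(E,\hat Y)$, $\operatorname{Mas}(E,Y)$ over $[a,b]$ (with $E$ regarded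 as a constant path) are well defined, i.e. such partitions and numbers exist and the value does not depend on their choice, and $$\operatorname{Mas}(Y,\hat Y)=\operatorname{Mas}(E,\hat Y)-\operatorname{Mas}(E,Y)+\mu(\hat Y(a),Y(a))-\mu(\hat Y(b),Y(b)).$$ If in addition $Y(a)=\hat Y(a)$ and $Y(b)=\hat Y(b)$, then $\operatorname{Mas}(Y,\hat Y)=\operatorname{Mas}(E,\hat Y)-\operatorname{Mas}(E,Y)$. -/

import Mathlib

open Matrix

namespace LagrangianMaslov

noncomputable section

/-! ### The Moore–Penrose pseudoinverse of a real matrix -/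

/-- The four Penrose equations for real matrices. -/
structure IsPseudoinverse {m n : Type*} [Fintype m] [Fintype n]
    (A : Matrix m n ℝ) (B : Matrix n m ℝ) : Prop where
  mul_mul_left : A * B * A = A
  mul_mul_right : B * A * B = B
  symm_left : (A * B)ᵀ = A * B
  symm_right : (B * A)ᵀ = B * A

theorem IsPseudoinverse.unique {m n : Type*} [Fintype m] [Fintype n]
    {A : Matrix m n ℝ} {B C : Matrix n m ℝ}
    (hB : IsPseudoinverse A B) (hC : IsPseudoinverse A C) : B = C := by
  have h1 : A * B = A * C := by
    calc A * B = (A * C * A) * B := by rw [hC.mul_mul_left]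
      _ = (A * C)ᵀ * (A * B)ᵀ := by
          rw [hC.symm_left, hB.symm_left]; simp only [Matrix.mul_assoc]
      _ = ((A * B * A) * C)ᵀ := by
          rw [← Matrix.transpose_mul]; simp only [Matrix.mul_assoc]
      _ = A * C := by rw [hB.mul_mul_left, hC.symm_left]
  have h2 : B * A = C * A := by
    calc B * A = B * (A * C * A) := by rw [hC.mul_mul_left]
      _ = (B * A)ᵀ * (C * A)ᵀ := by
          rw [hC.symm_right, hB.symm_right]; simp only [Matrix.mul_assoc]
      _ = (C * (A * B * A))ᵀ := by
          rw [← Matrix.transpose_mul]; simp only [Matrix.mul_assoc]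
      _ = C * A := by rw [hB.mul_mul_left, hC.symm_right]
  calc B = B * A * B := hB.mul_mul_right.symm
    _ = C * A * B := by rw [h2]
    _ = C * (A * B) := Matrix.mul_assoc _ _ _
    _ = C * A * C := by rw [h1, Matrix.mul_assoc]
    _ = C := hC.mul_mul_right

theorem exists_isPseudoinverse_of_isHermitian {n : Type*} [Fintype n] [DecidableEq n]
    {H : Matrix n n ℝ} (hH : H.IsHermitian) : ∃ G, IsPseudoinverse H G ∧ Gᵀ = G := by
  set U : Matrix n n ℝ := (hH.eigenvectorUnitary : Matrix n n ℝ) with hU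
  set d := hH.eigenvalues with hd
  have hUU : Uᵀ * U = 1 := by
    have := Unitary.coe_star_mul_self hH.eigenvectorUnitary
    simpa [Matrix.star_eq_conjTranspose, Matrix.conjTranspose_eq_transpose_of_trivial] using this
  have key : ∀ e f : n → ℝ, (U * diagonal e * Uᵀ) * (U * diagonal f * Uᵀ)
      = U * diagonal (fun i => e i * f i) * Uᵀ := by
    intro e f
    calc _ = U * diagonal e * (Uᵀ * U) * diagonal f * Uᵀ := by simp only [Matrix.mul_assoc]
      _ = _ := by
        rw [hUU, Matrix.mul_one, Matrix.mul_assoc U, diagonal_mul_diagonal]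
  have tr : ∀ e : n → ℝ, (U * diagonal e * Uᵀ)ᵀ = U * diagonal e * Uᵀ := by
    intro e; simp [Matrix.transpose_mul, Matrix.mul_assoc]
  have hspec : H = U * diagonal d * Uᵀ := by
    have := hH.spectral_theorem
    rw [Unitary.conjStarAlgAut_apply] at this
    simpa [Matrix.star_eq_conjTranspose, Matrix.conjTranspose_eq_transpose_of_trivial,
      Function.comp_def] using this
  refine ⟨U * diagonal (fun i => (d i)⁻¹) * Uᵀ, ⟨?_, ?_, ?_, ?_⟩, tr _⟩
  · rw [hspec, key, key]
    have : (fun i => d i * (d i)⁻¹ * d i) = d := by funext i; exact mul_inv_mul_cancel (d i)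
    rw [this]
  · rw [hspec, key, key]
    have : (fun i => (d i)⁻¹ * d i * (d i)⁻¹) = fun i => (d i)⁻¹ := by
      funext i; simpa using mul_inv_mul_cancel (d i)⁻¹
    rw [this]
  · rw [hspec, key, tr]
  · rw [hspec, key, tr]

theorem exists_isPseudoinverse {m n : Type*} [Fintype m] [Fintype n]
    (A : Matrix m n ℝ) : ∃ B, IsPseudoinverse A B := by
  classical
  obtain ⟨G, hG, hGt⟩ := exists_isPseudoinverse_of_isHermitian
    (H := Aᵀ * A) (by
      simpa [Matrix.conjTranspose_eq_transpose_of_trivial] using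
        Matrix.isHermitian_conjTranspose_mul_self A)
  have hA : A * (G * (Aᵀ * A)) = A := by
    have h0 : A - A * (G * (Aᵀ * A)) = 0 := by
      have h1 : Aᵀ * (A - A * (G * (Aᵀ * A))) = 0 := by
        rw [Matrix.mul_sub, sub_eq_zero, ← Matrix.mul_assoc, ← Matrix.mul_assoc]
        exact hG.mul_mul_left.symm
      have h2 : (A - A * (G * (Aᵀ * A)))ᵀ * (A - A * (G * (Aᵀ * A))) = 0 := by
        have h3 : (A - A * (G * (Aᵀ * A)))ᵀ = (1 - (G * (Aᵀ * A)))ᵀ * Aᵀ := by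
          rw [← Matrix.transpose_mul, Matrix.mul_sub, Matrix.mul_one]
        rw [h3, Matrix.mul_assoc, h1, Matrix.mul_zero]
      rw [← Matrix.conjTranspose_eq_transpose_of_trivial] at h2
      exact Matrix.conjTranspose_mul_self_eq_zero.mp h2
    exact (sub_eq_zero.mp h0).symm
  refine ⟨G * Aᵀ, ?_, ?_, ?_, ?_⟩
  · simpa only [Matrix.mul_assoc] using hA
  · have := hG.mul_mul_right
    calc G * Aᵀ * A * (G * Aᵀ) = (G * (Aᵀ * A) * G) * Aᵀ := by simp only [Matrix.mul_assoc]
      _ = G * Aᵀ := by rw [this]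
  · simp [Matrix.transpose_mul, hGt, Matrix.mul_assoc]
  · rw [Matrix.mul_assoc]; exact hG.symm_right

/-- The Moore–Penrose pseudoinverse: the unique solution of the four Penrose equations. -/
def pinv {m n : Type*} [Fintype m] [Fintype n] (A : Matrix m n ℝ) : Matrix n m ℝ :=
  Classical.choose (exists_isPseudoinverse A)

theorem pinv_spec {m n : Type*} [Fintype m] [Fintype n] (A : Matrix m n ℝ) :
    IsPseudoinverse A (pinv A) :=
  Classical.choose_spec (exists_isPseudoinverse A)

/-! ### Lagrangian planes and paths -/

/-- The canonical skew-symmetric matrix `(0 I; -I 0)`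
(this is the negative of `Matrix.J`). -/
def symJ (n : ℕ) : Matrix (Fin n ⊕ Fin n) (Fin n ⊕ Fin n) ℝ :=
  Matrix.fromBlocks 0 1 (-1) 0

/-- A real `2n × n` matrix `Y` with `Yᵀ 𝒥 Y = 0` and `rank Y = n`. -/
def IsLagrangian {n : ℕ} (Y : Matrix (Fin n ⊕ Fin n) (Fin n) ℝ) : Prop :=
  Yᵀ * symJ n * Y = 0 ∧ Y.rank = n

/-- A continuous Lagrangian path on `[a, b]`. -/
def IsLagrangianPath {n : ℕ} (a b : ℝ) (Y : ℝ → Matrix (Fin n ⊕ Fin n) (Fin n) ℝ) : Prop :=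
  ContinuousOn Y (Set.Icc a b) ∧ ∀ t ∈ Set.Icc a b, IsLagrangian (Y t)

/-- The vertical Lagrangian plane `E = (0 I)ᵀ`. -/
def vertical (n : ℕ) : Matrix (Fin n ⊕ Fin n) (Fin n) ℝ :=
  Matrix.fromRows 0 1

/-! ### The comparative index -/

/-- The Wronskian `W(Y, Ŷ) = Yᵀ 𝒥 Ŷ`. -/
def wronskian {n : ℕ} (Y Yh : Matrix (Fin n ⊕ Fin n) (Fin n) ℝ) : Matrix (Fin n) (Fin n) ℝ :=
  Yᵀ * symJ n * Yh

/-- `ℳ = (I - X† X) W(Y, Ŷ)`. -/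
def compM {n : ℕ} (Y Yh : Matrix (Fin n ⊕ Fin n) (Fin n) ℝ) : Matrix (Fin n) (Fin n) ℝ :=
  (1 - pinv Y.toRows₁ * Y.toRows₁) * wronskian Y Yh

/-- `V = I - ℳ† ℳ`. -/
def compV {n : ℕ} (Y Yh : Matrix (Fin n ⊕ Fin n) (Fin n) ℝ) : Matrix (Fin n) (Fin n) ℝ :=
  1 - pinv (compM Y Yh) * compM Y Yh

/-- `𝒫 = V W(Y, Ŷ)ᵀ X† X̂ V`. -/
def compP {n : ℕ} (Y Yh : Matrix (Fin n ⊕ Fin n) (Fin n) ℝ) : Matrix (Fin n) (Fin n) ℝ :=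
  compV Y Yh * (wronskian Y Yh)ᵀ * pinv Y.toRows₁ * Yh.toRows₁ * compV Y Yh

/-- The number of negative eigenvalues, counted with multiplicity. -/
def negIndex {n : ℕ} (P : Matrix (Fin n) (Fin n) ℝ) : ℕ :=
  (P.charpoly.roots.filter (fun x => x < 0)).card

/-- The comparative index `μ(Y, Ŷ) = rank ℳ + ind 𝒫`. -/
def compIndex {n : ℕ} (Y Yh : Matrix (Fin n ⊕ Fin n) (Fin n) ℝ) : ℕ :=
  (compM Y Yh).rank + negIndex (compP Y Yh)

/-! ### The Maslov index -/

/-- `X + i U` for `Y = (X; U)`. -/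
def cplus {n : ℕ} (Y : Matrix (Fin n ⊕ Fin n) (Fin n) ℝ) : Matrix (Fin n) (Fin n) ℂ :=
  Y.toRows₁.map Complex.ofReal + Complex.I • Y.toRows₂.map Complex.ofReal

/-- `X - i U` for `Y = (X; U)`. -/
def cminus {n : ℕ} (Y : Matrix (Fin n ⊕ Fin n) (Fin n) ℝ) : Matrix (Fin n) (Fin n) ℂ :=
  Y.toRows₁.map Complex.ofReal - Complex.I • Y.toRows₂.map Complex.ofReal

/-- `Γ = -(X + iU)(X - iU)⁻¹(X̂ - iÛ)(X̂ + iÛ)⁻¹`. -/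
def Gam {n : ℕ} (Y Yh : Matrix (Fin n ⊕ Fin n) (Fin n) ℝ) : Matrix (Fin n) (Fin n) ℂ :=
  -(cplus Y * (cminus Y)⁻¹ * cminus Yh * (cplus Yh)⁻¹)

/-- `Γ - exp(iα) I`. -/
def shift {n : ℕ} (G : Matrix (Fin n) (Fin n) ℂ) (α : ℝ) : Matrix (Fin n) (Fin n) ℂ :=
  G - Complex.exp (Complex.I * (α : ℂ)) • (1 : Matrix (Fin n) (Fin n) ℂ)

/-- The defect `def A = dim ker A`. -/
def defect {n : ℕ} (A : Matrix (Fin n) (Fin n) ℂ) : ℕ :=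
  Module.finrank ℂ (LinearMap.ker (Matrix.toLin' A))

/-- `ℓ = ∑_{θ ∈ [0, ε)} def (Γ - exp(i(π + θ)) I)`. For `ε ≤ π` only finitely many terms are
nonzero, because a matrix has finitely many eigenvalues. -/
def ell {n : ℕ} (G : Matrix (Fin n) (Fin n) ℂ) (ε : ℝ) : ℕ :=
  ∑ᶠ θ ∈ Set.Ico (0 : ℝ) ε, defect (shift G (Real.pi + θ))

/-- A partition `a = t₀ < t₁ < ⋯ < t_p = b` with numbers `ε_k ∈ (0, π)` such that
`exp(i(π ± ε_k))` is not an eigenvalue of `Γ(s)` for `s ∈ [t_{k-1}, t_k]`. -/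
structure MaslovPartition {n : ℕ} (a b : ℝ)
    (Y Yh : ℝ → Matrix (Fin n ⊕ Fin n) (Fin n) ℝ) where
  p : ℕ
  t : Fin (p + 1) → ℝ
  ε : Fin p → ℝ
  strictMono : StrictMono t
  first : t 0 = a
  last : t (Fin.last p) = b
  eps_mem : ∀ k, ε k ∈ Set.Ioo 0 Real.pi
  regular : ∀ k, ∀ s ∈ Set.Icc (t k.castSucc) (t k.succ),
    IsUnit (shift (Gam (Y s) (Yh s)) (Real.pi + ε k)) ∧
    IsUnit (shift (Gam (Y s) (Yh s)) (Real.pi - ε k))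

/-- `∑_k (ℓ(t_k, ε_k) - ℓ(t_{k-1}, ε_k))`. -/
def MaslovPartition.sum {n : ℕ} {a b : ℝ}
    {Y Yh : ℝ → Matrix (Fin n ⊕ Fin n) (Fin n) ℝ} (D : MaslovPartition a b Y Yh) : ℤ :=
  ∑ k : Fin D.p,
    ((ell (Gam (Y (D.t k.succ)) (Yh (D.t k.succ))) (D.ε k) : ℤ)
      - (ell (Gam (Y (D.t k.castSucc)) (Yh (D.t k.castSucc))) (D.ε k) : ℤ))

open Classical in
/-- The Maslov index `Mas(Y, Ŷ)` on `[a, b]`, computed from some admissible partition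
(and `0` if there were none). -/
def maslovIndex {n : ℕ} (a b : ℝ) (Y Yh : ℝ → Matrix (Fin n ⊕ Fin n) (Fin n) ℝ) : ℤ :=
  if h : Nonempty (MaslovPartition a b Y Yh) then h.some.sum else 0

/-- The Maslov index is well defined: admissible partitions exist and all of them give
the value `maslovIndex a b Y Yh`. -/
def MaslovWellDefined {n : ℕ} (a b : ℝ)
    (Y Yh : ℝ → Matrix (Fin n ⊕ Fin n) (Fin n) ℝ) : Prop :=
  Nonempty (MaslovPartition a b Y Yh) ∧
    ∀ D : MaslovPartition a b Y Yh, D.sum = maslovIndex a b Y Yh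

end

end LagrangianMaslov

namespace LagrangianMaslov

noncomputable section

/-! ### Spectral theory of unitary matrices -/

/-! Everything is reduced to sums of eigenvalue angles. The matrix `gam Y` = (X + iU)(X - iU)⁻¹ of a
Lagrangian plane is unitary, and Γ = -N with N = `relUnitary Y Yh`. For a unitary N, `angSum c N`
adds the angles of its eigenvalues taken in [c, c + 2π). It is always a logarithm of det N, and ℓ
counts the eigenvalues of N with angle in [0, ε), so `angSum (ε - 2π)` and `angSum 0` differ by 2π(n
- ℓ). On a piece of an admissible partition e^{iε} is not an eigenvalue, so `angSum (ε - 2π)` is a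
continuous lift of det N and differs from any other lift α by a constant. Telescoping gives 2π Mas =
Δα - Δ`angSum 0`, Δ being the increment from a to b (`MaslovPartition.two_pi_mul_sum`). No partition
occurs on the right, hence Mas is well defined.

Lifts of det `gam` for Y, Ŷ and E yield lifts for all three pairs, and these cancel in Mas(Y, Ŷ) -
Mas(E, Ŷ) + Mas(E, Y). What is left is minus the increment of `tripleAngle` over 2π, so the formula
follows from the pointwise identity `tripleAngle Y Yh` = 2π μ(Ŷ, Y) (`tripleAngle_eq_compIndex`).

For that identity, `tripleAngle` takes values in 2πℤ and stays constant along deformations that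
preserve the ranks of the three Wronskians. It is therefore invariant under symplectic shears, which
fix E. A shear brings Ŷ to a coordinate plane; a small rotation in the right direction leaves
`tripleAngle` unchanged and makes this plane a graph over the horizontal plane; a second shear makes
it horizontal. Against the horizontal plane all three unitary matrices are diagonal in one basis,
and Sylvester's law of inertia gives 2π ind(XᵀU). Undoing the reductions leaves the index of a
pencil A + tC - t⁻¹B for small t > 0, which is rank B + ind(VAV) with V the orthogonal projection
onto ker B (`negIndex_pencil`). Finally ker B = ker ℳ and VAV = 𝒫. -/

theorem exists_norm_one_not_mem_spectrum {n : ℕ} (N : Matrix (Fin n) (Fin n) ℂ) :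
    ∃ z : ℂ, ‖z‖ = 1 ∧ z ∉ spectrum ℂ N := by
  have hinf : (Metric.sphere (0 : ℂ) 1).Infinite := by
    have h : Set.InjOn (fun t : ℝ => (Circle.exp t : ℂ)) (Set.Ico 0 1) := by
      intro x hx y hy hxy
      exact Circle.exp_injOn_Ico (a := 0) (b := 1) (by linarith [Real.pi_gt_three]) hx hy
        (Circle.ext hxy)
    refine ((Set.Ico_infinite (zero_lt_one : (0 : ℝ) < 1)).image h).mono ?_
    rintro _ ⟨t, -, rfl⟩
    simp
  obtain ⟨z, hz, hz'⟩ := hinf.exists_notMem_finite (Matrix.finite_spectrum N)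
  exact ⟨z, by simpa using hz, hz'⟩

theorem star_mul_self_of_norm_one {z : ℂ} (hz : ‖z‖ = 1) : star z * z = 1 := by
  rw [Complex.star_def, Complex.conj_mul', hz]; norm_num

/-- Unitary diagonalization, through the Cayley transform. -/
theorem exists_unitary_diagonalization {n : ℕ} {N : Matrix (Fin n) (Fin n) ℂ}
    (hN : N ∈ unitaryGroup (Fin n) ℂ) :
    ∃ P ∈ unitaryGroup (Fin n) ℂ, ∃ d : Fin n → ℂ, (∀ i, ‖d i‖ = 1) ∧
      N = P * diagonal d * Pᴴ := by
  obtain ⟨z, hz, hzN⟩ := exists_norm_one_not_mem_spectrum N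
  have hNN : Nᴴ * N = 1 := by simpa [star_eq_conjTranspose] using (mem_unitaryGroup_iff'.mp hN)
  set B : Matrix (Fin n) (Fin n) ℂ := z • 1 - N with hB
  have hBu : IsUnit B := by
    rw [spectrum.notMem_iff, Algebra.algebraMap_eq_smul_one] at hzN
    exact hzN
  have hBdet : IsUnit B.det := (isUnit_iff_isUnit_det _).mp hBu
  have hzz := star_mul_self_of_norm_one hz
  -- The map w ↦ i(z + w)/(z - w) sends the unit circle without z to the real line, so H is
  -- Hermitian.
  set H : Matrix (Fin n) (Fin n) ℂ := Complex.I • ((z • 1 + N) * B⁻¹) with hH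
  have hcomm : (z • 1 + N) * B⁻¹ = B⁻¹ * (z • 1 + N) := by
    have h1 : B * (z • 1 + N) = (z • 1 + N) * B := by
      simp only [hB, Matrix.sub_mul, Matrix.add_mul, Matrix.mul_add, Matrix.mul_sub,
        Matrix.smul_mul, Matrix.mul_smul, Matrix.one_mul, Matrix.mul_one, smul_add, smul_sub]
      abel
    calc (z • 1 + N) * B⁻¹ = B⁻¹ * (B * (z • 1 + N)) * B⁻¹ := by
          rw [← Matrix.mul_assoc B⁻¹, nonsing_inv_mul _ hBdet, Matrix.one_mul]
      _ = B⁻¹ * ((z • 1 + N) * (B * B⁻¹)) := by rw [h1]; simp only [Matrix.mul_assoc]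
      _ = _ := by rw [mul_nonsing_inv _ hBdet, Matrix.mul_one]
  have hBH : Bᴴ = -(star z • (Nᴴ * B)) := by
    rw [hB, conjTranspose_sub, conjTranspose_smul, conjTranspose_one, Matrix.mul_sub, hNN,
      Matrix.mul_smul, Matrix.mul_one, smul_sub, smul_smul, hzz, one_smul]
    abel
  have hCH : (z • 1 + N)ᴴ = star z • (Nᴴ * (z • 1 + N)) := by
    rw [conjTranspose_add, conjTranspose_smul, conjTranspose_one, Matrix.mul_add, hNN,
      Matrix.mul_smul, Matrix.mul_one, smul_add, smul_smul, hzz, one_smul]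
    abel
  have hHH : H.IsHermitian := by
    have h2 : Bᴴ * (B⁻¹ * (z • 1 + N)) = -(z • 1 + N)ᴴ := by
      rw [hBH, hCH, Matrix.neg_mul, Matrix.smul_mul, Matrix.mul_assoc,
        ← Matrix.mul_assoc B, mul_nonsing_inv _ hBdet, Matrix.one_mul]
    have hBHdet : IsUnit Bᴴ.det := by rw [det_conjTranspose]; exact hBdet.star
    have h3 : B⁻¹ * (z • 1 + N) = -((Bᴴ)⁻¹ * (z • 1 + N)ᴴ) := by
      rw [← Matrix.mul_neg, ← h2, ← Matrix.mul_assoc, nonsing_inv_mul _ hBHdet, Matrix.one_mul]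
    rw [IsHermitian, hH, conjTranspose_smul, conjTranspose_mul, conjTranspose_nonsing_inv, hcomm,
      h3]
    simp
  -- This inverts the transform: N = z - 2iz (H + i)⁻¹, so a unitary eigenbasis of H diagonalizes N.
  have hHI : (H + Complex.I • 1) * B = (2 * Complex.I * z) • 1 := by
    rw [hH, Matrix.add_mul, Matrix.smul_mul, Matrix.mul_assoc, nonsing_inv_mul _ hBdet,
      Matrix.mul_one, Matrix.smul_mul, Matrix.one_mul, ← smul_add, hB]
    rw [show z • (1 : Matrix (Fin n) (Fin n) ℂ) + N + (z • 1 - N) = z • 1 + z • 1 by abel,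
      ← add_smul, smul_smul]
    congr 1
    ring
  have hspec := hHH.spectral_theorem
  rw [Unitary.conjStarAlgAut_apply] at hspec
  set P : Matrix (Fin n) (Fin n) ℂ := (hHH.eigenvectorUnitary : Matrix (Fin n) (Fin n) ℂ) with hP
  have hPu : P ∈ unitaryGroup (Fin n) ℂ := hHH.eigenvectorUnitary.2
  have hPP : Pᴴ * P = 1 := by simpa [star_eq_conjTranspose] using (mem_unitaryGroup_iff'.mp hPu)
  have hPP' : P * Pᴴ = 1 := by simpa [star_eq_conjTranspose] using (mem_unitaryGroup_iff.mp hPu)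
  set h := hHH.eigenvalues
  set d : Fin n → ℂ := fun i => z - 2 * Complex.I * z / ((h i : ℂ) + Complex.I) with hd
  have hne : ∀ i, ((h i : ℂ) + Complex.I) ≠ 0 := by
    intro i hi
    have := congrArg Complex.im hi
    simp at this
  have hND : N = P * diagonal d * Pᴴ := by
    have hHI' : H + Complex.I • 1 = P * diagonal (fun i => (h i : ℂ) + Complex.I) * Pᴴ := by
      have : diagonal (fun i => (h i : ℂ) + Complex.I)
          = diagonal (RCLike.ofReal ∘ h) + Complex.I • (1 : Matrix (Fin n) (Fin n) ℂ) := by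
        rw [smul_one_eq_diagonal, diagonal_add]
        rfl
      rw [this, Matrix.mul_add, Matrix.add_mul, Matrix.mul_smul, Matrix.mul_one, Matrix.smul_mul,
        hPP', hspec]
      rfl
    have hB' : B = P * diagonal (fun i => 2 * Complex.I * z / ((h i : ℂ) + Complex.I)) * Pᴴ := by
      calc B = (P * diagonal (fun i => ((h i : ℂ) + Complex.I)⁻¹) * Pᴴ) *
            ((H + Complex.I • 1) * B) := by
            rw [← Matrix.mul_assoc, hHI']
            have : P * diagonal (fun i => ((h i : ℂ) + Complex.I)⁻¹) * Pᴴ *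
                (P * diagonal (fun i => (h i : ℂ) + Complex.I) * Pᴴ) = 1 := by
              calc _ = P * diagonal (fun i => ((h i : ℂ) + Complex.I)⁻¹) * (Pᴴ * P) *
                    diagonal (fun i => (h i : ℂ) + Complex.I) * Pᴴ := by
                    simp only [Matrix.mul_assoc]
                _ = P * (diagonal (fun i => ((h i : ℂ) + Complex.I)⁻¹) *
                    diagonal (fun i => (h i : ℂ) + Complex.I)) * Pᴴ := by
                    rw [hPP, Matrix.mul_one]; simp only [Matrix.mul_assoc]
                _ = 1 := by
                    rw [diagonal_mul_diagonal]
                    simp only [inv_mul_cancel₀ (hne _)]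
                    rw [diagonal_one, Matrix.mul_one, hPP']
            rw [this, Matrix.one_mul]
        _ = _ := by
            rw [hHI, Matrix.mul_smul, Matrix.mul_one, ← Matrix.smul_mul, ← Matrix.mul_smul,
              ← diagonal_smul]
            congr 3
    have : N = z • 1 - B := by rw [hB]; abel
    rw [this, hB']
    have h5 : diagonal d = z • (1 : Matrix (Fin n) (Fin n) ℂ)
        - diagonal (fun i => 2 * Complex.I * z / ((h i : ℂ) + Complex.I)) := by
      rw [smul_one_eq_diagonal, diagonal_sub]
    rw [h5, Matrix.mul_sub, Matrix.sub_mul, Matrix.mul_smul, Matrix.mul_one, Matrix.smul_mul, hPP']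
  refine ⟨P, hPu, d, ?_, hND⟩
  intro i
  have h6 : d i = z * ((h i : ℂ) - Complex.I) / ((h i : ℂ) + Complex.I) := by
    rw [hd]; field_simp [hne i]; ring
  have h7 : ‖(h i : ℂ) - Complex.I‖ = ‖(h i : ℂ) + Complex.I‖ := by
    rw [← Complex.norm_conj]; simp
  rw [h6, norm_div, norm_mul, hz, one_mul, h7, div_self]
  exact norm_ne_zero_iff.mpr (hne i)

theorem conjTranspose_mul_self_of_mem_unitaryGroup {n : ℕ} {P : Matrix (Fin n) (Fin n) ℂ}
    (hP : P ∈ unitaryGroup (Fin n) ℂ) : Pᴴ * P = 1 := by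
  simpa [star_eq_conjTranspose] using mem_unitaryGroup_iff'.mp hP

theorem mul_conjTranspose_self_of_mem_unitaryGroup {n : ℕ} {P : Matrix (Fin n) (Fin n) ℂ}
    (hP : P ∈ unitaryGroup (Fin n) ℂ) : P * Pᴴ = 1 := by
  simpa [star_eq_conjTranspose] using mem_unitaryGroup_iff.mp hP

/-- The sum of `f` over the eigenvalues, counted with algebraic multiplicity. -/
def eigSum {n : ℕ} (f : ℂ → ℝ) (N : Matrix (Fin n) (Fin n) ℂ) : ℝ :=
  (N.charpoly.roots.map f).sum

theorem charpoly_conj {n : ℕ} {P D : Matrix (Fin n) (Fin n) ℂ}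
    (hP : P ∈ unitaryGroup (Fin n) ℂ) : (P * D * Pᴴ).charpoly = D.charpoly := by
  rw [charpoly_mul_comm, ← Matrix.mul_assoc, conjTranspose_mul_self_of_mem_unitaryGroup hP,
    Matrix.one_mul]

theorem eigSum_diagonalization {n : ℕ} (f : ℂ → ℝ) {P : Matrix (Fin n) (Fin n) ℂ}
    (hP : P ∈ unitaryGroup (Fin n) ℂ) (d : Fin n → ℂ) :
    eigSum f (P * diagonal d * Pᴴ) = ∑ i, f (d i) := by
  rw [eigSum, charpoly_conj hP, charpoly_diagonal, Polynomial.roots_prod]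
  · simp [Polynomial.roots_X_sub_C, List.sum_ofFn]
  · simp [Finset.prod_ne_zero_iff, Polynomial.X_sub_C_ne_zero]

/-- Conjugation of diagonal matrices by a unitary matrix, as a star algebra homomorphism. -/
def diagConj {n : ℕ} (P : Matrix (Fin n) (Fin n) ℂ) (hP : P ∈ unitaryGroup (Fin n) ℂ) :
    (Fin n → ℂ) →⋆ₐ[ℂ] Matrix (Fin n) (Fin n) ℂ where
  toFun d := P * diagonal d * Pᴴ
  map_one' := by
    change P * diagonal (fun _ => 1) * Pᴴ = 1
    rw [diagonal_one, Matrix.mul_one, mul_conjTranspose_self_of_mem_unitaryGroup hP]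
  map_mul' d e := by
    calc P * diagonal (d * e) * Pᴴ = P * (diagonal d * diagonal e) * Pᴴ := by
          rw [diagonal_mul_diagonal]; rfl
      _ = P * diagonal d * (Pᴴ * P) * diagonal e * Pᴴ := by
          rw [conjTranspose_mul_self_of_mem_unitaryGroup hP, Matrix.mul_one]
          simp only [Matrix.mul_assoc]
      _ = _ := by simp only [Matrix.mul_assoc]
  map_zero' := by
    change P * diagonal (fun _ => 0) * Pᴴ = 0
    simp
  map_add' d e := by
    rw [← Matrix.add_mul, ← Matrix.mul_add, diagonal_add]; rfl
  commutes' r := by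
    change P * diagonal (fun _ => r) * Pᴴ = _
    rw [← smul_one_eq_diagonal, Matrix.mul_smul, Matrix.mul_one, Matrix.smul_mul,
      mul_conjTranspose_self_of_mem_unitaryGroup hP, Algebra.algebraMap_eq_smul_one]
  map_star' d := by
    rw [star_eq_conjTranspose]
    simp [conjTranspose_mul, diagonal_conjTranspose, Matrix.mul_assoc]

-- Functional calculus commutes with the star homomorphism `diagConj`, so on a diagonalized matrix
-- it acts entrywise. Any f is allowed, since the spectrum is finite and f is continuous on it.
open scoped Matrix.Norms.L2Operator in
theorem trace_cfc_eq_eigSum {n : ℕ} (f : ℂ → ℝ) {N : Matrix (Fin n) (Fin n) ℂ}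
    (hN : N ∈ unitaryGroup (Fin n) ℂ) :
    (cfc (fun z => (f z : ℂ)) N).trace = (eigSum f N : ℂ) := by
  obtain ⟨P, hP, d, -, rfl⟩ := exists_unitary_diagonalization hN
  have hspd : ∀ i, (spectrum ℂ (d i)).Finite := fun i => by
    have : spectrum ℂ (d i) = {d i} := spectrum.scalar_eq (𝕜 := ℂ) (A := ℂ) (d i)
    rw [this]; exact Set.finite_singleton _
  have h1 : cfc (fun z => (f z : ℂ)) d = fun i => ((f (d i) : ℝ) : ℂ) := by
    rw [cfc_map_pi (S := ℂ) (q := fun _ => IsStarNormal) (p := IsStarNormal)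
      (A := fun _ : Fin n => ℂ) (fun z => (f z : ℂ)) d
      ((Set.finite_iUnion hspd).continuousOn _) ⟨mul_comm _ _⟩ (fun i => ⟨mul_comm _ _⟩)]
    funext i
    have : d i = algebraMap ℂ ℂ (d i) := rfl
    rw [this, cfc_algebraMap]; rfl
  have hcont : Continuous (diagConj P hP) := by
    change Continuous fun d : Fin n → ℂ => P * diagonal d * Pᴴ
    fun_prop
  have hsp : ContinuousOn (fun z => (f z : ℂ)) (spectrum ℂ d) := by
    refine Set.Finite.continuousOn ?_ _
    rw [Pi.spectrum_eq]
    exact Set.finite_iUnion hspd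
  have h2 := StarAlgHomClass.map_cfc (p := IsStarNormal) (q := IsStarNormal) (S := ℂ)
    (diagConj P hP) (fun z => (f z : ℂ)) d hsp hcont
    ⟨mul_comm _ _⟩ (by
      constructor
      rw [commute_iff_eq, ← map_star, ← map_mul, ← map_mul, mul_comm])
  have h3 : diagConj P hP d = P * diagonal d * Pᴴ := rfl
  rw [h3] at h2
  rw [← h2, h1, eigSum_diagonalization f hP]
  change (P * diagonal _ * Pᴴ).trace = _
  rw [trace_mul_comm, ← Matrix.mul_assoc, conjTranspose_mul_self_of_mem_unitaryGroup hP,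
    Matrix.one_mul, trace_diagonal]
  simp

theorem isStarNormal_of_mem_unitaryGroup {n : ℕ} {N : Matrix (Fin n) (Fin n) ℂ}
    (hN : N ∈ unitaryGroup (Fin n) ℂ) : IsStarNormal N :=
  ⟨by rw [commute_iff_eq, mem_unitaryGroup_iff.mp hN, mem_unitaryGroup_iff'.mp hN]⟩

-- The sum is the trace of f(N), and f(N) depends continuously on N while the spectra stay in an
-- open set where f is continuous. No continuous choice of individual eigenvalues is needed.
open scoped Matrix.Norms.L2Operator in
theorem continuousOn_eigSum {n : ℕ} {f : ℂ → ℝ} {O : Set ℂ} (hO : IsOpen O)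
    (hf : ContinuousOn f O) {N : ℝ → Matrix (Fin n) (Fin n) ℂ} {s : Set ℝ}
    (hN : ContinuousOn N s) (hu : ∀ t ∈ s, N t ∈ unitaryGroup (Fin n) ℂ)
    (hs : ∀ t ∈ s, spectrum ℂ (N t) ⊆ O) :
    ContinuousOn (fun t => eigSum f (N t)) s := by
  have h1 : ContinuousOn (fun t => cfc (fun z => (f z : ℂ)) (N t)) s := by
    refine ContinuousOn.cfc_of_mem_nhdsSet (s := O) (p := IsStarNormal) _ ?_ hN
      (fun t ht => isStarNormal_of_mem_unitaryGroup (hu t ht)) ?_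
    · rw [hO.mem_nhdsSet]
      exact Set.iUnion₂_subset hs
    · exact Complex.continuous_ofReal.comp_continuousOn hf
  have h2 : ContinuousOn (fun t => (cfc (fun z => (f z : ℂ)) (N t)).trace.re) s := by
    refine Complex.continuous_re.comp_continuousOn ?_
    exact (Continuous.matrix_trace continuous_id).comp_continuousOn h1
  refine h2.congr fun t ht => ?_
  simp only
  rw [trace_cfc_eq_eigSum f (hu t ht), Complex.ofReal_re]

/-! ### Angles in a prescribed fundamental interval -/

/-- The argument of `z` in `[c, c + 2π)`. -/
def ang (c : ℝ) (z : ℂ) : ℝ := toIcoMod Real.two_pi_pos c z.arg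

theorem ang_mem (c : ℝ) (z : ℂ) : ang c z ∈ Set.Ico c (c + 2 * Real.pi) :=
  toIcoMod_mem_Ico _ _ _

theorem exp_toIcoMod (c x : ℝ) :
    Complex.exp ((toIcoMod Real.two_pi_pos c x : ℝ) * Complex.I) = Complex.exp (x * Complex.I) := by
  rw [toIcoMod, Complex.exp_eq_exp_iff_exists_int]
  refine ⟨-toIcoDiv Real.two_pi_pos c x, ?_⟩
  rw [zsmul_eq_mul]
  push_cast
  ring

theorem exp_ang (c : ℝ) {z : ℂ} (hz : ‖z‖ = 1) : Complex.exp (ang c z * Complex.I) = z := by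
  have := Complex.norm_mul_exp_arg_mul_I z
  rw [hz, Complex.ofReal_one, one_mul] at this
  rw [ang, exp_toIcoMod, this]

theorem ang_real_mul_exp {c x r : ℝ} (hr : 0 < r) (hx : x ∈ Set.Ico c (c + 2 * Real.pi)) :
    ang c (r * Complex.exp (x * Complex.I)) = x := by
  rw [ang, Complex.arg_real_mul _ hr, Complex.arg_exp_mul_I, toIcoMod_eq_iff]
  refine ⟨hx, -toIocDiv Real.two_pi_pos (-Real.pi) x, ?_⟩
  rw [toIocMod, neg_zsmul, sub_eq_add_neg]

theorem ang_exp {c x : ℝ} (hx : x ∈ Set.Ico c (c + 2 * Real.pi)) :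
    ang c (Complex.exp (x * Complex.I)) = x := by
  simpa using ang_real_mul_exp one_pos hx

theorem ang_eq_iff {c x : ℝ} (hx : x ∈ Set.Ico c (c + 2 * Real.pi)) {z : ℂ} (hz : ‖z‖ = 1) :
    ang c z = x ↔ z = Complex.exp (x * Complex.I) := by
  constructor
  · rintro rfl; exact (exp_ang c hz).symm
  · rintro rfl; exact ang_exp hx

/-- The open set where `ang c` is continuous. -/
def angDomain (c : ℝ) : Set ℂ :=
  {z | z * Complex.exp (((-(c + Real.pi) : ℝ) : ℂ) * Complex.I) ∈ Complex.slitPlane}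

theorem isOpen_angDomain (c : ℝ) : IsOpen (angDomain c) :=
  Complex.isOpen_slitPlane.preimage (by fun_prop)

/-- Multiplication by e^{-i(c + π)} carries the cut at angle c to the negative real axis, the cut of
`Complex.arg`. -/
theorem continuousOn_ang (c : ℝ) : ContinuousOn (ang c) (angDomain c) := by
  have h : ContinuousOn (fun z : ℂ =>
      (z * Complex.exp (((-(c + Real.pi) : ℝ) : ℂ) * Complex.I)).arg + (c + Real.pi))
      (angDomain c) := by
    refine ContinuousOn.add (fun z hz => ?_) continuousOn_const
    refine ContinuousAt.continuousWithinAt ?_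
    exact ContinuousAt.comp (f := fun z : ℂ => z * Complex.exp (((-(c + Real.pi) : ℝ) : ℂ) *
      Complex.I)) (Complex.continuousAt_arg hz) (by fun_prop)
  refine h.congr fun z hz => ?_
  set w := z * Complex.exp (((-(c + Real.pi) : ℝ) : ℂ) * Complex.I) with hw
  have hw' := Complex.mem_slitPlane_iff_arg.mp (show w ∈ Complex.slitPlane from hz)
  have hz' : z = ‖w‖ * Complex.exp (((w.arg + (c + Real.pi) : ℝ) : ℂ) * Complex.I) := by
    have h1 := Complex.norm_mul_exp_arg_mul_I w
    push_cast
    rw [add_mul, Complex.exp_add, ← mul_assoc, h1, hw, mul_assoc, ← Complex.exp_add]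
    push_cast
    rw [← add_mul, neg_add_cancel, zero_mul, Complex.exp_zero, mul_one]
  conv_lhs => rw [hz']
  refine ang_real_mul_exp (norm_pos_iff.mpr hw'.2) ⟨?_, ?_⟩
  · linarith [Complex.neg_pi_lt_arg w]
  · have := lt_of_le_of_ne (Complex.arg_le_pi w) hw'.1
    linarith

theorem mem_angDomain {c : ℝ} {z : ℂ} (hz : ‖z‖ = 1) (h : z ≠ Complex.exp (c * Complex.I)) :
    z ∈ angDomain c := by
  rw [angDomain, Set.mem_ofPred_eq, Complex.mem_slitPlane_iff_arg]
  refine ⟨fun harg => h ?_, mul_ne_zero (norm_ne_zero_iff.mp (by rw [hz]; norm_num))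
    (Complex.exp_ne_zero _)⟩
  set w := z * Complex.exp (((-(c + Real.pi) : ℝ) : ℂ) * Complex.I) with hw
  have h1 := Complex.norm_mul_exp_arg_mul_I w
  have h2 : ‖w‖ = 1 := by rw [hw, norm_mul, hz, Complex.norm_exp_ofReal_mul_I, one_mul]
  rw [h2, harg, Complex.ofReal_one, one_mul] at h1
  have h3 : z = w * Complex.exp (((c + Real.pi : ℝ) : ℂ) * Complex.I) := by
    rw [hw, mul_assoc, ← Complex.exp_add]
    push_cast
    rw [← add_mul, neg_add_cancel, zero_mul, Complex.exp_zero, mul_one]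
  rw [h3, ← h1, ← Complex.exp_add, Complex.exp_eq_exp_iff_exists_int]
  exact ⟨1, by push_cast; ring⟩

theorem exp_sub_two_pi_mul_I (x : ℝ) : Complex.exp (((x - 2 * Real.pi : ℝ) : ℂ) * Complex.I)
    = Complex.exp ((x : ℂ) * Complex.I) := by
  rw [Complex.exp_eq_exp_iff_exists_int]
  exact ⟨-1, by push_cast; ring⟩

/-- Moving the window from [0, 2π) to [ε - 2π, ε) keeps the angles below ε and lowers the others by
2π. -/
theorem ang_sub_two_pi {ε : ℝ} (hε : ε ∈ Set.Ioo 0 (2 * Real.pi)) {z : ℂ} (hz : ‖z‖ = 1) :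
    ang (ε - 2 * Real.pi) z = if ang 0 z < ε then ang 0 z else ang 0 z - 2 * Real.pi := by
  have h0 := ang_mem 0 z
  have hz' := exp_ang 0 hz
  simp only [Set.mem_Ico, Set.mem_Ioo, zero_add] at h0 hε
  split_ifs with h
  · rw [ang_eq_iff _ hz, hz']
    constructor <;> linarith
  · rw [ang_eq_iff _ hz]
    · conv_lhs => rw [← hz']
      rw [Complex.exp_eq_exp_iff_exists_int]
      exact ⟨1, by push_cast; ring⟩
    · constructor <;> linarith

/-! ### Sums of angles of eigenvalues of a unitary matrix -/

/-- The sum of the angles in `[c, c + 2π)` of the eigenvalues. -/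
def angSum {n : ℕ} (c : ℝ) (N : Matrix (Fin n) (Fin n) ℂ) : ℝ := eigSum (ang c) N

theorem mem_spectrum_diagonalization {n : ℕ} {P : Matrix (Fin n) (Fin n) ℂ}
    (hP : P ∈ unitaryGroup (Fin n) ℂ) (d : Fin n → ℂ) (z : ℂ) :
    z ∈ spectrum ℂ (P * diagonal d * Pᴴ) ↔ ∃ i, d i = z := by
  rw [mem_spectrum_iff_isRoot_charpoly, charpoly_conj hP, charpoly_diagonal, Polynomial.IsRoot,
    Polynomial.eval_prod, Finset.prod_eq_zero_iff]
  simp [sub_eq_zero, eq_comm]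

theorem det_diagonalization {n : ℕ} {P : Matrix (Fin n) (Fin n) ℂ}
    (hP : P ∈ unitaryGroup (Fin n) ℂ) (d : Fin n → ℂ) :
    (P * diagonal d * Pᴴ).det = ∏ i, d i := by
  rw [det_mul_comm, ← Matrix.mul_assoc, conjTranspose_mul_self_of_mem_unitaryGroup hP,
    Matrix.one_mul, det_diagonal]

theorem diagonalization_sub_smul_one {n : ℕ} {P : Matrix (Fin n) (Fin n) ℂ}
    (hP : P ∈ unitaryGroup (Fin n) ℂ) (d : Fin n → ℂ) (z : ℂ) :
    P * diagonal d * Pᴴ - z • 1 = P * diagonal (fun i => d i - z) * Pᴴ := by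
  rw [← diagonal_sub, ← smul_one_eq_diagonal, Matrix.mul_sub, Matrix.sub_mul, Matrix.mul_smul,
    Matrix.mul_one, Matrix.smul_mul, mul_conjTranspose_self_of_mem_unitaryGroup hP]

theorem rank_diagonalization {n : ℕ} {P : Matrix (Fin n) (Fin n) ℂ}
    (hP : P ∈ unitaryGroup (Fin n) ℂ) (d : Fin n → ℂ) :
    (P * diagonal d * Pᴴ).rank = (Finset.univ.filter fun i => d i ≠ 0).card := by
  have h1 : IsUnit P.det := by
    rw [← isUnit_iff_isUnit_det]
    exact ⟨⟨P, Pᴴ, mul_conjTranspose_self_of_mem_unitaryGroup hP,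
      conjTranspose_mul_self_of_mem_unitaryGroup hP⟩, rfl⟩
  have h2 : IsUnit Pᴴ.det := by rw [det_conjTranspose]; exact h1.star
  rw [rank_mul_eq_left_of_isUnit_det _ _ h2, rank_mul_eq_right_of_isUnit_det _ _ h1, rank_diagonal,
    Fintype.card_subtype]

/-- The determinant is the product of the eigenvalues, so the angle sum is one of its logarithms
whatever the cut c. -/
theorem exp_angSum {n : ℕ} (c : ℝ) {N : Matrix (Fin n) (Fin n) ℂ}
    (hN : N ∈ unitaryGroup (Fin n) ℂ) : Complex.exp (angSum c N * Complex.I) = N.det := by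
  obtain ⟨P, hP, d, hd, rfl⟩ := exists_unitary_diagonalization hN
  rw [angSum, eigSum_diagonalization _ hP, det_diagonalization hP]
  push_cast
  rw [Finset.sum_mul, Complex.exp_sum]
  exact Finset.prod_congr rfl fun i _ => exp_ang c (hd i)

/-- Jumps occur only when an eigenvalue meets the cut at e^{ic}, which invertibility excludes. -/
theorem continuousOn_angSum {n : ℕ} {c : ℝ} {N : ℝ → Matrix (Fin n) (Fin n) ℂ} {s : Set ℝ}
    (hN : ContinuousOn N s) (hu : ∀ t ∈ s, N t ∈ unitaryGroup (Fin n) ℂ)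
    (hs : ∀ t ∈ s, IsUnit (N t - Complex.exp (c * Complex.I) • 1)) :
    ContinuousOn (fun t => angSum c (N t)) s := by
  refine continuousOn_eigSum (isOpen_angDomain c) (continuousOn_ang c) hN hu ?_
  intro t ht z hz
  have hne : z ≠ Complex.exp (c * Complex.I) := by
    rintro rfl
    revert hz
    rw [imp_false, spectrum.notMem_iff, Algebra.algebraMap_eq_smul_one, ← neg_sub, IsUnit.neg_iff]
    exact hs t ht
  obtain ⟨P, hP, d, hd, hNt⟩ := exists_unitary_diagonalization (hu t ht)
  rw [hNt, mem_spectrum_diagonalization hP] at hz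
  obtain ⟨i, rfl⟩ := hz
  exact mem_angDomain (hd i) hne

theorem shift_neg {n : ℕ} (N : Matrix (Fin n) (Fin n) ℂ) (θ : ℝ) :
    shift (-N) (Real.pi + θ) = -(N - Complex.exp (θ * Complex.I) • 1) := by
  have : Complex.exp (Complex.I * ((Real.pi + θ : ℝ) : ℂ)) = -Complex.exp (θ * Complex.I) := by
    push_cast
    rw [mul_add, Complex.exp_add, mul_comm Complex.I (Real.pi : ℂ), Complex.exp_pi_mul_I,
      mul_comm Complex.I]
    ring
  rw [shift, this, neg_smul]
  abel

theorem defect_shift_neg_diagonalization {n : ℕ} {P : Matrix (Fin n) (Fin n) ℂ}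
    (hP : P ∈ unitaryGroup (Fin n) ℂ) (d : Fin n → ℂ) (θ : ℝ) :
    defect (shift (-(P * diagonal d * Pᴴ)) (Real.pi + θ))
      = (Finset.univ.filter fun i => d i = Complex.exp (θ * Complex.I)).card := by
  have h1 := rank_diagonalization hP fun i => -(d i - Complex.exp (θ * Complex.I))
  have h2 : shift (-(P * diagonal d * Pᴴ)) (Real.pi + θ)
      = P * diagonal (fun i => -(d i - Complex.exp (θ * Complex.I))) * Pᴴ := by
    rw [shift_neg, diagonalization_sub_smul_one hP, ← diagonal_neg, Matrix.mul_neg,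
      Matrix.neg_mul]
  rw [← h2] at h1
  have h3 := LinearMap.finrank_range_add_finrank_ker
    (toLin' (shift (-(P * diagonal d * Pᴴ)) (Real.pi + θ)))
  rw [Module.finrank_fin_fun] at h3
  have h4 := Finset.card_filter_add_card_filter_not (s := (Finset.univ : Finset (Fin n)))
    (p := fun i => d i = Complex.exp (θ * Complex.I))
  have h5 : (Finset.univ.filter fun i => -(d i - Complex.exp (θ * Complex.I)) ≠ 0)
      = Finset.univ.filter fun i => ¬ d i = Complex.exp (θ * Complex.I) := by
    ext i; simp [sub_eq_zero, eq_comm]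
  rw [h5] at h1
  rw [Finset.card_univ, Fintype.card_fin] at h4
  rw [Matrix.rank, ← toLin'_apply'] at h1
  rw [defect]
  omega

/-- The sign in Γ = -N absorbs the shift by π, and as ε < 2π each eigenvalue contributes for at most
one θ, namely its angle in [0, 2π). -/
theorem ell_neg_diagonalization {n : ℕ} {P : Matrix (Fin n) (Fin n) ℂ}
    (hP : P ∈ unitaryGroup (Fin n) ℂ) {d : Fin n → ℂ} (hd : ∀ i, ‖d i‖ = 1) {ε : ℝ}
    (hε : ε ∈ Set.Ioo 0 (2 * Real.pi)) :
    ell (-(P * diagonal d * Pᴴ)) ε = (Finset.univ.filter fun i => ang 0 (d i) < ε).card := by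
  set F := Finset.univ.filter fun i => ang 0 (d i) < ε with hF
  set T := F.image fun i => ang 0 (d i) with hT
  have hcard : ∀ θ ∈ Set.Ico (0 : ℝ) ε,
      defect (shift (-(P * diagonal d * Pᴴ)) (Real.pi + θ))
        = (F.filter fun i => ang 0 (d i) = θ).card := by
    intro θ hθ
    rw [defect_shift_neg_diagonalization hP]
    congr 1
    ext i
    have : θ ∈ Set.Ico (0 : ℝ) (0 + 2 * Real.pi) := ⟨hθ.1, by linarith [hθ.2, hε.2]⟩
    simp only [hF, Finset.mem_filter, Finset.mem_univ, true_and]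
    rw [ang_eq_iff this (hd i)]
    refine ⟨fun h => ⟨?_, h⟩, fun h => h.2⟩
    rw [(ang_eq_iff this (hd i)).mpr h]
    exact hθ.2
  have hmaps : Set.MapsTo (fun i => ang 0 (d i)) ↑F ↑T := fun i hi =>
    Finset.mem_coe.mpr (Finset.mem_image_of_mem _ hi)
  have hTsub : (↑T : Set ℝ) ⊆ Set.Ico 0 ε := by
    intro θ hθ
    obtain ⟨i, hi, rfl⟩ := Finset.mem_image.mp (Finset.mem_coe.mp hθ)
    exact ⟨(ang_mem 0 _).1, (Finset.mem_filter.mp hi).2⟩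
  rw [ell, Finset.card_eq_sum_card_fiberwise hmaps, finsum_mem_congr rfl hcard,
    finsum_mem_eq_sum_of_inter_support_eq (t := T)]
  ext θ
  simp only [Set.mem_inter_iff, Function.mem_support]
  refine ⟨fun h => ⟨?_, h.2⟩, fun h => ⟨hTsub h.1, h.2⟩⟩
  obtain ⟨i, hi⟩ := Finset.card_pos.mp (Nat.pos_of_ne_zero h.2)
  rw [Finset.mem_filter] at hi
  rw [← hi.2]
  exact hmaps hi.1

theorem sum_ite_sub {n : ℕ} (p : Fin n → Prop) [DecidablePred p] (x : Fin n → ℝ) (r : ℝ) :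
    ∑ i, (if p i then x i else x i - r)
      = ∑ i, x i - r * ((n : ℝ) - (Finset.univ.filter p).card) := by
  have h : ∀ i, (if p i then x i else x i - r) = x i - r + r * (if p i then 1 else 0) := by
    intro i; split_ifs <;> ring
  simp only [h, Finset.sum_add_distrib, Finset.sum_sub_distrib, ← Finset.mul_sum, Finset.sum_boole,
    Finset.sum_const, Finset.card_univ, Fintype.card_fin, nsmul_eq_mul]
  ring

theorem angSum_sub_two_pi_diagonalization {n : ℕ} {P : Matrix (Fin n) (Fin n) ℂ}
    (hP : P ∈ unitaryGroup (Fin n) ℂ) {d : Fin n → ℂ} (hd : ∀ i, ‖d i‖ = 1) {ε : ℝ}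
    (hε : ε ∈ Set.Ioo 0 (2 * Real.pi)) :
    angSum (ε - 2 * Real.pi) (P * diagonal d * Pᴴ) = angSum 0 (P * diagonal d * Pᴴ)
      - 2 * Real.pi * ((n : ℝ) - (Finset.univ.filter fun i => ang 0 (d i) < ε).card) := by
  rw [angSum, angSum, eigSum_diagonalization _ hP, eigSum_diagonalization _ hP, ← sum_ite_sub]
  exact Finset.sum_congr rfl fun i _ => ang_sub_two_pi hε (hd i)

theorem angSum_sub_two_pi {n : ℕ} {N : Matrix (Fin n) (Fin n) ℂ}
    (hN : N ∈ unitaryGroup (Fin n) ℂ) {ε : ℝ} (hε : ε ∈ Set.Ioo 0 (2 * Real.pi)) :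
    angSum (ε - 2 * Real.pi) N = angSum 0 N - 2 * Real.pi * ((n : ℝ) - ell (-N) ε) := by
  obtain ⟨P, hP, d, hd, rfl⟩ := exists_unitary_diagonalization hN
  rw [angSum_sub_two_pi_diagonalization hP hd hε, ell_neg_diagonalization hP hd hε]

/-- The angle sum is continuous from the right under rotation. -/
theorem angSum_rotate {n : ℕ} {N : Matrix (Fin n) (Fin n) ℂ}
    (hN : N ∈ unitaryGroup (Fin n) ℂ) :
    ∃ δ₀ > 0, ∀ δ ∈ Set.Ico 0 δ₀,
      angSum 0 (Complex.exp ((δ : ℝ) * Complex.I) • N) = angSum 0 N + n * δ := by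
  obtain ⟨P, hP, d, hd, rfl⟩ := exists_unitary_diagonalization hN
  -- The window is open at 2π, so there is room to turn every eigenvalue forward without crossing;
  -- an eigenvalue 1, at the closed end 0, moves inwards.
  obtain ⟨δ₀, hδ₀, h⟩ : ∃ δ₀ > 0, ∀ i, ang 0 (d i) + δ₀ ≤ 2 * Real.pi := by
    have : ∀ᶠ δ in nhdsWithin (0 : ℝ) (Set.Ioi 0), ∀ i, ang 0 (d i) + δ ≤ 2 * Real.pi := by
      rw [Filter.eventually_all]
      intro i
      have h1 : 0 < 2 * Real.pi - ang 0 (d i) := by linarith [(ang_mem 0 (d i)).2]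
      filter_upwards [Ioo_mem_nhdsGT h1] with δ hδ
      linarith [hδ.2]
    obtain ⟨δ, h1, h2⟩ := (this.and self_mem_nhdsWithin).exists
    exact ⟨δ, h2, h1⟩
  refine ⟨δ₀, hδ₀, fun δ hδ => ?_⟩
  have h1 : Complex.exp (δ * Complex.I) • (P * diagonal d * Pᴴ)
      = P * diagonal (fun i => Complex.exp (δ * Complex.I) * d i) * Pᴴ := by
    rw [← Matrix.smul_mul, ← Matrix.mul_smul, ← diagonal_smul]
    rfl
  rw [h1, angSum, angSum, eigSum_diagonalization _ hP, eigSum_diagonalization _ hP]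
  have h2 : ∀ i, ang 0 (Complex.exp (δ * Complex.I) * d i) = ang 0 (d i) + δ := by
    intro i
    have h0 := ang_mem 0 (d i)
    rw [ang_eq_iff]
    · conv_lhs => rw [← exp_ang 0 (hd i), ← Complex.exp_add]
      push_cast
      ring_nf
    · constructor
      · linarith [h0.1, hδ.1]
      · linarith [h i, hδ.2]
    · rw [norm_mul, Complex.norm_exp_ofReal_mul_I, hd, one_mul]
  simp [h2, Finset.sum_add_distrib]

theorem isUnit_nhdsWithin {n : ℕ} {N : ℝ → Matrix (Fin n) (Fin n) ℂ} {s : Set ℝ} {t₀ : ℝ}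
    (hN : ContinuousWithinAt N s t₀) (h : IsUnit (N t₀)) :
    ∀ᶠ t in nhdsWithin t₀ s, IsUnit (N t) := by
  have hdet : ContinuousWithinAt (fun t => (N t).det) s t₀ :=
    (Continuous.matrix_det continuous_id).continuousAt.comp_continuousWithinAt hN
  rw [isUnit_iff_isUnit_det, isUnit_iff_ne_zero] at h
  filter_upwards [hdet.eventually_ne h] with t ht
  rw [isUnit_iff_isUnit_det, isUnit_iff_ne_zero]
  exact ht

theorem isUnit_diagonalization_sub_iff {n : ℕ} {P : Matrix (Fin n) (Fin n) ℂ}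
    (hP : P ∈ unitaryGroup (Fin n) ℂ) (d : Fin n → ℂ) (z : ℂ) :
    IsUnit (P * diagonal d * Pᴴ - z • 1) ↔ ∀ i, d i ≠ z := by
  have h := (mem_spectrum_diagonalization hP d z).not
  rw [spectrum.notMem_iff, Algebra.algebraMap_eq_smul_one, ← neg_sub, IsUnit.neg_iff] at h
  simpa using h

/-- The angle sum is continuous along paths on which the multiplicity of the eigenvalue `1` is
constant. -/
theorem continuousOn_angSum_zero {n r : ℕ} {N : ℝ → Matrix (Fin n) (Fin n) ℂ} {s : Set ℝ}
    (hN : ContinuousOn N s) (hu : ∀ t ∈ s, N t ∈ unitaryGroup (Fin n) ℂ)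
    (hr : ∀ t ∈ s, (N t - 1).rank = r) :
    ContinuousOn (fun t => angSum 0 (N t)) s := by
  intro t₀ ht₀
  have hpi := Real.pi_pos
  have hcount : ∀ t ∈ s, ∃ P ∈ unitaryGroup (Fin n) ℂ, ∃ d : Fin n → ℂ, (∀ i, ‖d i‖ = 1) ∧
      N t = P * diagonal d * Pᴴ ∧ (Finset.univ.filter fun i => ang 0 (d i) ≠ 0).card = r := by
    intro t ht
    obtain ⟨P, hP, d, hd, h⟩ := exists_unitary_diagonalization (hu t ht)
    refine ⟨P, hP, d, hd, h, ?_⟩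
    have h1 := diagonalization_sub_smul_one hP d 1
    rw [one_smul] at h1
    rw [← hr t ht, h, h1, rank_diagonalization hP]
    congr 1
    ext i
    simp only [Finset.mem_filter, Finset.mem_univ, true_and, ne_eq, sub_eq_zero]
    rw [ang_eq_iff ⟨le_rfl, by linarith⟩ (hd i)]
    simp
  obtain ⟨P, hP, d, hd, hNt, hrd⟩ := hcount t₀ ht₀
  -- This ε isolates the eigenvalue 1 of `N t₀` from both sides, so the cuts at angles ε and -ε are
  -- usable near t₀.
  obtain ⟨ε, hε0, hεpi, hε⟩ : ∃ ε > 0, ε < Real.pi ∧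
      ∀ i, ang 0 (d i) ≠ 0 → ε < ang 0 (d i) ∧ ang 0 (d i) < 2 * Real.pi - ε := by
    have : ∀ᶠ ε in nhdsWithin (0 : ℝ) (Set.Ioi 0),
        ∀ i, ang 0 (d i) ≠ 0 → ε < ang 0 (d i) ∧ ang 0 (d i) < 2 * Real.pi - ε := by
      rw [Filter.eventually_all]
      intro i
      by_cases h0 : ang 0 (d i) = 0
      · simp [h0]
      have h1 : 0 < 2 * Real.pi - ang 0 (d i) := by linarith [(ang_mem 0 (d i)).2]
      have h2 : 0 < ang 0 (d i) := lt_of_le_of_ne (ang_mem 0 (d i)).1 (Ne.symm h0)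
      filter_upwards [Ioo_mem_nhdsGT h1, Ioo_mem_nhdsGT h2] with ε h3 h4 _
      exact ⟨h4.2, by linarith [h3.2]⟩
    obtain ⟨ε, ⟨h1, h2⟩, h3⟩ := ((this.and (Ioo_mem_nhdsGT hpi)).and self_mem_nhdsWithin).exists
    exact ⟨ε, h3, h2.2, h1⟩
  have hεI : ε ∈ Set.Ioo 0 (2 * Real.pi) := ⟨hε0, by linarith⟩
  have hεI' : 2 * Real.pi - ε ∈ Set.Ioo 0 (2 * Real.pi) := ⟨by linarith, by linarith⟩
  have hunit : ∀ x ∈ Set.Ioo 0 (2 * Real.pi), (∀ i, ang 0 (d i) ≠ x) →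
      IsUnit (N t₀ - Complex.exp ((x : ℝ) * Complex.I) • 1) := by
    intro x hx h
    rw [hNt, isUnit_diagonalization_sub_iff hP]
    intro i hi
    exact h i ((ang_eq_iff ⟨hx.1.le, by linarith [hx.2]⟩ (hd i)).mpr hi)
  have hu1 := hunit ε hεI fun i hi => by
    have := hε i (by rw [hi]; exact hε0.ne')
    linarith [this.1]
  have hu2 := hunit _ hεI' fun i hi => by
    have := hε i (by rw [hi]; linarith)
    linarith [this.2]
  set U : Set ℝ := {t ∈ s | IsUnit (N t - Complex.exp ((ε : ℝ) * Complex.I) • 1) ∧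
    IsUnit (N t - Complex.exp (((2 * Real.pi - ε : ℝ) : ℂ) * Complex.I) • 1)} with hU
  have hUs : U ⊆ s := fun t ht => ht.1
  have hUmem : U ∈ nhdsWithin t₀ s := by
    filter_upwards [self_mem_nhdsWithin,
      isUnit_nhdsWithin (N := fun t => N t - Complex.exp ((ε : ℝ) * Complex.I) • 1)
        ((hN t₀ ht₀).sub continuousWithinAt_const) hu1,
      isUnit_nhdsWithin (N := fun t => N t -
        Complex.exp (((2 * Real.pi - ε : ℝ) : ℂ) * Complex.I) • 1)
        ((hN t₀ ht₀).sub continuousWithinAt_const) hu2] with t h1 h2 h3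
    exact ⟨h1, h2, h3⟩
  have ht₀U : t₀ ∈ U := ⟨ht₀, hu1, hu2⟩
  have hc1 : ContinuousOn (fun t => angSum (ε - 2 * Real.pi) (N t)) U :=
    continuousOn_angSum (hN.mono hUs) (fun t ht => hu t ht.1) fun t ht => by
      rw [exp_sub_two_pi_mul_I]; exact ht.2.1
  have hc2 : ContinuousOn (fun t => angSum (2 * Real.pi - ε - 2 * Real.pi) (N t)) U :=
    continuousOn_angSum (hN.mono hUs) (fun t ht => hu t ht.1) fun t ht => by
      rw [exp_sub_two_pi_mul_I]; exact ht.2.2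
  have hc3 := (hc2.sub hc1) t₀ ht₀U
  have hcompl : ∀ e : Fin n → ℂ, (Finset.univ.filter fun i => ang 0 (e i) = 0).card +
      (Finset.univ.filter fun i => ang 0 (e i) ≠ 0).card = n := by
    intro e
    simpa using Finset.card_filter_add_card_filter_not (s := (Finset.univ : Finset (Fin n)))
      (p := fun i => ang 0 (e i) = 0)
  have hzero : ∀ e : Fin n → ℂ, (Finset.univ.filter fun i => ang 0 (e i) = 0) ⊆
      Finset.univ.filter fun i => ang 0 (e i) < ε := by
    intro e i hi
    simp only [Finset.mem_filter, Finset.mem_univ, true_and] at hi ⊢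
    linarith
  -- At `t₀` all nontrivial angles lie between `ε` and `2π - ε`.
  have hval : angSum (2 * Real.pi - ε - 2 * Real.pi) (N t₀) - angSum (ε - 2 * Real.pi) (N t₀)
      = 2 * Real.pi * r := by
    rw [hNt, angSum_sub_two_pi_diagonalization hP hd hεI,
      angSum_sub_two_pi_diagonalization hP hd hεI']
    have h1 : (Finset.univ.filter fun i => ang 0 (d i) < ε)
        = Finset.univ.filter fun i => ang 0 (d i) = 0 := by
      refine subset_antisymm (fun i hi => ?_) (hzero d)
      simp only [Finset.mem_filter, Finset.mem_univ, true_and] at hi ⊢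
      by_contra h
      linarith [(hε i h).1]
    have h2 : (Finset.univ.filter fun i => ang 0 (d i) < 2 * Real.pi - ε) = Finset.univ := by
      refine Finset.filter_true_of_mem fun i _ => ?_
      by_cases h : ang 0 (d i) = 0
      · rw [h]; linarith
      · exact (hε i h).2
    have h3 := hcompl d
    rw [hrd] at h3
    have h4 : ((Finset.univ.filter fun i => ang 0 (d i) = 0).card : ℝ) + r = n := by
      exact_mod_cast h3
    rw [h1, h2, Finset.card_univ, Fintype.card_fin]
    linear_combination (-2 * Real.pi) * h4
  -- The difference is 2π times the number of angles in [ε, 2π - ε). By continuity this integer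
  -- exceeds r - 1 near t₀, and only r angles are nonzero. Hence no nonzero angle is below ε:
  -- eigenvalues leaving 1, in either direction, are ruled out.
  have hclose : ∀ᶠ t in nhdsWithin t₀ U,
      2 * Real.pi * ((r : ℝ) - 1) <
        angSum (2 * Real.pi - ε - 2 * Real.pi) (N t) - angSum (ε - 2 * Real.pi) (N t) :=
    hc3.eventually (lt_mem_nhds (by
      change _ < angSum (2 * Real.pi - ε - 2 * Real.pi) (N t₀) - angSum (ε - 2 * Real.pi) (N t₀)
      rw [hval]; nlinarith))
  have hfin : ∀ᶠ t in nhdsWithin t₀ U,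
      angSum 0 (N t) = angSum (ε - 2 * Real.pi) (N t) + 2 * Real.pi * r := by
    filter_upwards [hclose, self_mem_nhdsWithin] with t ht htU
    obtain ⟨Q, hQ, e, he, hNe, hre⟩ := hcount t htU.1
    rw [hNe, angSum_sub_two_pi_diagonalization hQ he hεI,
      angSum_sub_two_pi_diagonalization hQ he hεI'] at ht
    rw [hNe, angSum_sub_two_pi_diagonalization hQ he hεI]
    have h1 := Finset.card_le_card (hzero e)
    have h2 := hcompl e
    rw [hre] at h2
    have h3 : (Finset.univ.filter fun i => ang 0 (e i) < 2 * Real.pi - ε).card ≤ n := by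
      simpa using Finset.card_filter_le (Finset.univ : Finset (Fin n)) _
    have h4 : (r : ℝ) - 1 < (Finset.univ.filter fun i => ang 0 (e i) < 2 * Real.pi - ε).card
        - (Finset.univ.filter fun i => ang 0 (e i) < ε).card := by
      have h2pi : 0 < 2 * Real.pi := by linarith
      refine lt_of_mul_lt_mul_left ?_ h2pi.le
      linarith
    have h5 : (r : ℤ) - 1 < (Finset.univ.filter fun i => ang 0 (e i) < 2 * Real.pi - ε).card
        - (Finset.univ.filter fun i => ang 0 (e i) < ε).card := by exact_mod_cast h4
    have h6 : (Finset.univ.filter fun i => ang 0 (e i) < ε).card + r = n := by omega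
    have h7 : ((Finset.univ.filter fun i => ang 0 (e i) < ε).card : ℝ) + r = n := by
      exact_mod_cast h6
    linear_combination (-2 * Real.pi) * h7
  have hU' : nhdsWithin t₀ s = nhdsWithin t₀ U :=
    le_antisymm (nhdsWithin_le_iff.mpr hUmem) (nhdsWithin_mono _ hUs)
  rw [ContinuousWithinAt, hU']
  have h7 := (hc1 t₀ ht₀U).add (continuousWithinAt_const (b := 2 * Real.pi * (r : ℝ)))
  refine h7.congr_of_eventuallyEq hfin ?_
  exact hfin.self_of_nhdsWithin ht₀U

/-- The function (f - f a)/2π is continuous and integer valued on an interval; a nonzero value at b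
would force the value 1/2 or -1/2 in between. -/
theorem eq_of_exp_eq_of_continuousOn {f : ℝ → ℝ} {a b : ℝ} (hab : a ≤ b)
    (hf : ContinuousOn f (Set.Icc a b)) {w : ℂ}
    (h : ∀ t ∈ Set.Icc a b, Complex.exp (f t * Complex.I) = w) : f a = f b := by
  have hpi := Real.two_pi_pos
  set g : ℝ → ℝ := fun t => (f t - f a) / (2 * Real.pi) with hg
  have hgc : ContinuousOn g (Set.Icc a b) := (hf.sub continuousOn_const).div_const _
  have hgint : ∀ t ∈ Set.Icc a b, ∃ k : ℤ, (k : ℝ) = g t := by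
    intro t ht
    have h1 := (h t ht).trans (h a ⟨le_rfl, hab⟩).symm
    rw [Complex.exp_eq_exp_iff_exists_int] at h1
    obtain ⟨k, hk⟩ := h1
    refine ⟨k, ?_⟩
    have h2 : (f t : ℂ) = ((f a + k * (2 * Real.pi) : ℝ) : ℂ) := by
      apply mul_right_cancel₀ Complex.I_ne_zero
      rw [hk]; push_cast; ring
    have h3 := Complex.ofReal_injective h2
    rw [hg]
    simp only
    rw [h3]
    field_simp
    ring
  have hg0 : g a = 0 := by simp [hg]
  by_contra hne
  have hgb : g b ≠ 0 := by
    rw [hg]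
    exact div_ne_zero (sub_ne_zero.mpr (Ne.symm hne)) hpi.ne'
  have himg : (g '' Set.Icc a b).OrdConnected :=
    (isPreconnected_Icc.image g hgc).ordConnected
  obtain ⟨k, hk⟩ := hgint b ⟨hab, le_rfl⟩
  have hk0 : k ≠ 0 := by rintro rfl; exact hgb (by rw [← hk]; simp)
  have hma : g a ∈ g '' Set.Icc a b := ⟨a, ⟨le_rfl, hab⟩, rfl⟩
  have hmb : g b ∈ g '' Set.Icc a b := ⟨b, ⟨hab, le_rfl⟩, rfl⟩
  rcases lt_or_gt_of_ne hk0 with hneg | hpos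
  · have hk1 : (k : ℝ) ≤ -1 := by exact_mod_cast (by omega : k ≤ -1)
    obtain ⟨t, ht, hgt⟩ := himg.out hmb hma (⟨by linarith, by linarith⟩ :
      (-(1 / 2) : ℝ) ∈ Set.Icc (g b) (g a))
    obtain ⟨m, hm⟩ := hgint t ht
    rw [hgt] at hm
    have : (2 * m : ℝ) = -1 := by linarith
    have : (2 * m : ℤ) = -1 := by exact_mod_cast this
    omega
  · have hk1 : (1 : ℝ) ≤ k := by exact_mod_cast (by omega : 1 ≤ k)
    obtain ⟨t, ht, hgt⟩ := himg.out hma hmb (⟨by linarith, by linarith⟩ :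
      ((1 / 2) : ℝ) ∈ Set.Icc (g a) (g b))
    obtain ⟨m, hm⟩ := hgint t ht
    rw [hgt] at hm
    have : (2 * m : ℝ) = 1 := by linarith
    have : (2 * m : ℤ) = 1 := by exact_mod_cast this
    omega

/-! ### The unitary matrix of a Lagrangian plane -/

theorem map_ofReal_mul {l m k : Type*} [Fintype m] (A : Matrix l m ℝ) (B : Matrix m k ℝ) :
    (A * B).map Complex.ofReal = A.map Complex.ofReal * B.map Complex.ofReal :=
  Matrix.map_mul (f := Complex.ofRealHom)

theorem map_ofReal_sub {l m : Type*} (A B : Matrix l m ℝ) :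
    (A - B).map Complex.ofReal = A.map Complex.ofReal - B.map Complex.ofReal := by
  ext; simp

theorem map_ofReal_add {l m : Type*} (A B : Matrix l m ℝ) :
    (A + B).map Complex.ofReal = A.map Complex.ofReal + B.map Complex.ofReal := by
  ext; simp

theorem map_ofReal_conjTranspose {l m : Type*} (A : Matrix l m ℝ) :
    (A.map Complex.ofReal)ᴴ = Aᵀ.map Complex.ofReal := by
  ext; simp

theorem isUnit_map_ofReal {n : ℕ} {A : Matrix (Fin n) (Fin n) ℝ} (hA : IsUnit A) :
    IsUnit (A.map Complex.ofReal) :=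
  hA.map (Complex.ofRealHom.mapMatrix : Matrix (Fin n) (Fin n) ℝ →+* _)

theorem isUnit_of_rank_eq {n : ℕ} {A : Matrix (Fin n) (Fin n) ℝ} (h : A.rank = n) : IsUnit A := by
  rw [← mulVec_surjective_iff_isUnit]
  change Function.Surjective A.mulVecLin
  rw [← LinearMap.range_eq_top]
  refine Submodule.eq_top_of_finrank_eq ?_
  rw [Module.finrank_fin_fun]
  exact h

theorem wronskian_eq {n : ℕ} (Y Yh : Matrix (Fin n ⊕ Fin n) (Fin n) ℝ) :
    wronskian Y Yh = Y.toRows₁ᵀ * Yh.toRows₂ - Y.toRows₂ᵀ * Yh.toRows₁ := by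
  conv_lhs => rw [wronskian, symJ, ← fromRows_toRows Y, ← fromRows_toRows Yh, Matrix.mul_assoc,
    fromBlocks_mul_fromRows, transpose_fromRows, fromCols_mul_fromRows]
  simp [sub_eq_add_neg]

theorem transpose_mul_self_eq {n : ℕ} (Y : Matrix (Fin n ⊕ Fin n) (Fin n) ℝ) :
    Yᵀ * Y = Y.toRows₁ᵀ * Y.toRows₁ + Y.toRows₂ᵀ * Y.toRows₂ := by
  conv_lhs => rw [← fromRows_toRows Y, transpose_fromRows, fromCols_mul_fromRows]

theorem IsLagrangian.wronskian_self {n : ℕ} {Y : Matrix (Fin n ⊕ Fin n) (Fin n) ℝ}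
    (hY : IsLagrangian Y) : wronskian Y Y = 0 := hY.1

theorem IsLagrangian.symm {n : ℕ} {Y : Matrix (Fin n ⊕ Fin n) (Fin n) ℝ}
    (hY : IsLagrangian Y) : Y.toRows₁ᵀ * Y.toRows₂ = Y.toRows₂ᵀ * Y.toRows₁ := by
  have := hY.wronskian_self
  rwa [wronskian_eq, sub_eq_zero] at this

theorem cminus_conjTranspose {n : ℕ} (Y : Matrix (Fin n ⊕ Fin n) (Fin n) ℝ) :
    (cminus Y)ᴴ = (cplus Y)ᵀ := by
  ext i j; simp [cminus, cplus]

theorem cplus_conjTranspose {n : ℕ} (Y : Matrix (Fin n ⊕ Fin n) (Fin n) ℝ) :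
    (cplus Y)ᴴ = (cminus Y)ᵀ := by
  rw [← conjTranspose_conjTranspose (cminus Y), cminus_conjTranspose]
  ext; simp

theorem cplus_transpose_mul_cminus {n : ℕ} (Y Yh : Matrix (Fin n ⊕ Fin n) (Fin n) ℝ) :
    (cplus Y)ᵀ * cminus Yh =
      (Y.toRows₁ᵀ * Yh.toRows₁ + Y.toRows₂ᵀ * Yh.toRows₂).map Complex.ofReal
        - Complex.I • (wronskian Y Yh).map Complex.ofReal := by
  rw [wronskian_eq, cplus, cminus]
  simp only [map_ofReal_add, map_ofReal_sub, map_ofReal_mul, transpose_map, transpose_add,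
    transpose_smul, Matrix.add_mul, Matrix.mul_sub, Matrix.smul_mul, Matrix.mul_smul, smul_smul,
    Complex.I_mul_I, smul_sub, smul_add, neg_smul, one_smul]
  abel

theorem cminus_transpose_mul_cplus {n : ℕ} (Y Yh : Matrix (Fin n ⊕ Fin n) (Fin n) ℝ) :
    (cminus Y)ᵀ * cplus Yh =
      (Y.toRows₁ᵀ * Yh.toRows₁ + Y.toRows₂ᵀ * Yh.toRows₂).map Complex.ofReal
        + Complex.I • (wronskian Y Yh).map Complex.ofReal := by
  rw [wronskian_eq, cplus, cminus]
  simp only [map_ofReal_add, map_ofReal_sub, map_ofReal_mul, transpose_map, transpose_sub,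
    transpose_smul, Matrix.sub_mul, Matrix.mul_add, Matrix.smul_mul, Matrix.mul_smul, smul_smul,
    Complex.I_mul_I, smul_sub, neg_smul, one_smul]
  abel

theorem IsLagrangian.cplus_transpose_mul_cminus {n : ℕ}
    {Y : Matrix (Fin n ⊕ Fin n) (Fin n) ℝ} (hY : IsLagrangian Y) :
    (cplus Y)ᵀ * cminus Y = (Yᵀ * Y).map Complex.ofReal := by
  rw [LagrangianMaslov.cplus_transpose_mul_cminus, hY.wronskian_self, transpose_mul_self_eq]
  simp

theorem IsLagrangian.cminus_transpose_mul_cplus {n : ℕ}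
    {Y : Matrix (Fin n ⊕ Fin n) (Fin n) ℝ} (hY : IsLagrangian Y) :
    (cminus Y)ᵀ * cplus Y = (Yᵀ * Y).map Complex.ofReal := by
  rw [LagrangianMaslov.cminus_transpose_mul_cplus, hY.wronskian_self, transpose_mul_self_eq]
  simp

/-- Isotropy makes (X + iU)ᵀ(X - iU) the real Gram matrix YᵀY, which full rank makes invertible. -/
theorem IsLagrangian.isUnit_det {n : ℕ} {Y : Matrix (Fin n ⊕ Fin n) (Fin n) ℝ}
    (hY : IsLagrangian Y) : IsUnit (cminus Y).det ∧ IsUnit (cplus Y).det := by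
  have h1 : IsUnit (Yᵀ * Y) := isUnit_of_rank_eq (by rw [rank_transpose_mul_self, hY.2])
  have h2 := (isUnit_iff_isUnit_det _).mp (isUnit_map_ofReal h1)
  rw [← hY.cplus_transpose_mul_cminus, det_mul, det_transpose, IsUnit.mul_iff] at h2
  exact h2.symm

/-- The unitary matrix `(X + iU)(X - iU)⁻¹` of a Lagrangian plane. -/
def gam {n : ℕ} (Y : Matrix (Fin n ⊕ Fin n) (Fin n) ℝ) : Matrix (Fin n) (Fin n) ℂ :=
  cplus Y * (cminus Y)⁻¹

theorem IsLagrangian.gam_mul_cminus {n : ℕ} {Y : Matrix (Fin n ⊕ Fin n) (Fin n) ℝ}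
    (hY : IsLagrangian Y) : gam Y * cminus Y = cplus Y := by
  rw [gam, Matrix.mul_assoc, nonsing_inv_mul _ hY.isUnit_det.1, Matrix.mul_one]

/-- Compared with the transpose of `gam_mul_cminus`, this says that `gam Y` is a symmetric matrix;
unitarity follows after conjugation. -/
theorem IsLagrangian.cminus_transpose_mul_gam {n : ℕ} {Y : Matrix (Fin n ⊕ Fin n) (Fin n) ℝ}
    (hY : IsLagrangian Y) : (cminus Y)ᵀ * gam Y = (cplus Y)ᵀ := by
  rw [gam, ← Matrix.mul_assoc, hY.cminus_transpose_mul_cplus, ← hY.cplus_transpose_mul_cminus,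
    Matrix.mul_assoc, mul_nonsing_inv _ hY.isUnit_det.1, Matrix.mul_one]

theorem gam_eq_of_mul_cminus {n : ℕ} {Y : Matrix (Fin n ⊕ Fin n) (Fin n) ℝ}
    (hY : IsLagrangian Y) {G : Matrix (Fin n) (Fin n) ℂ} (h : G * cminus Y = cplus Y) :
    gam Y = G := by
  rw [gam, ← h, Matrix.mul_assoc, mul_nonsing_inv _ hY.isUnit_det.1, Matrix.mul_one]

theorem IsLagrangian.conjTranspose_gam_mul_cplus {n : ℕ}
    {Y : Matrix (Fin n ⊕ Fin n) (Fin n) ℝ} (hY : IsLagrangian Y) :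
    (gam Y)ᴴ * cplus Y = cminus Y := by
  have h := congrArg (fun M => star M) hY.cminus_transpose_mul_gam
  simp only [star_eq_conjTranspose, conjTranspose_mul] at h
  rwa [← cplus_conjTranspose, ← cminus_conjTranspose, conjTranspose_conjTranspose,
    conjTranspose_conjTranspose] at h

theorem IsLagrangian.gam_mem_unitaryGroup {n : ℕ} {Y : Matrix (Fin n ⊕ Fin n) (Fin n) ℝ}
    (hY : IsLagrangian Y) : gam Y ∈ unitaryGroup (Fin n) ℂ := by
  rw [mem_unitaryGroup_iff', star_eq_conjTranspose]
  have h : (gam Y)ᴴ * gam Y * cminus Y = cminus Y := by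
    rw [Matrix.mul_assoc, hY.gam_mul_cminus, hY.conjTranspose_gam_mul_cplus]
  calc (gam Y)ᴴ * gam Y = (gam Y)ᴴ * gam Y * cminus Y * (cminus Y)⁻¹ := by
        rw [Matrix.mul_assoc _ (cminus Y), mul_nonsing_inv _ hY.isUnit_det.1, Matrix.mul_one]
    _ = 1 := by rw [h, mul_nonsing_inv _ hY.isUnit_det.1]

/-- The unitary matrix `-Γ` of a pair of Lagrangian planes. -/
def relUnitary {n : ℕ} (Y Yh : Matrix (Fin n ⊕ Fin n) (Fin n) ℝ) : Matrix (Fin n) (Fin n) ℂ :=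
  gam Y * (gam Yh)ᴴ

theorem relUnitary_mem {n : ℕ} {Y Yh : Matrix (Fin n ⊕ Fin n) (Fin n) ℝ}
    (hY : IsLagrangian Y) (hYh : IsLagrangian Yh) :
    relUnitary Y Yh ∈ unitaryGroup (Fin n) ℂ :=
  mul_mem hY.gam_mem_unitaryGroup (Unitary.star_mem hYh.gam_mem_unitaryGroup)

theorem Gam_eq_neg {n : ℕ} (Y : Matrix (Fin n ⊕ Fin n) (Fin n) ℝ)
    {Yh : Matrix (Fin n ⊕ Fin n) (Fin n) ℝ} (hYh : IsLagrangian Yh) :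
    Gam Y Yh = -relUnitary Y Yh := by
  rw [Gam, relUnitary, Matrix.mul_assoc _ (cminus Yh)]
  congr 2
  rw [← hYh.conjTranspose_gam_mul_cplus, Matrix.mul_assoc, mul_nonsing_inv _ hYh.isUnit_det.2,
    Matrix.mul_one]

theorem det_relUnitary {n : ℕ} (Y Yh : Matrix (Fin n ⊕ Fin n) (Fin n) ℝ) :
    (relUnitary Y Yh).det = (gam Y).det * star (gam Yh).det := by
  rw [relUnitary, det_mul, det_conjTranspose]

/-- Multiplying N - 1 by invertible factors on both sides gives -2i times the Wronskian. The
multiplicity of the eigenvalue 1 is thus controlled by a real quantity that symplectic maps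
preserve. -/
theorem rank_relUnitary_sub_one {n : ℕ} {Y Yh : Matrix (Fin n ⊕ Fin n) (Fin n) ℝ}
    (hY : IsLagrangian Y) (hYh : IsLagrangian Yh) :
    (relUnitary Y Yh - 1).rank = ((wronskian Y Yh).map Complex.ofReal).rank := by
  have h1 : (cminus Y)ᵀ * (relUnitary Y Yh - 1) * cplus Yh
      = (-(2 * Complex.I)) • (wronskian Y Yh).map Complex.ofReal := by
    rw [Matrix.mul_sub, Matrix.mul_one, Matrix.sub_mul, relUnitary, ← Matrix.mul_assoc,
      hY.cminus_transpose_mul_gam, Matrix.mul_assoc, hYh.conjTranspose_gam_mul_cplus,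
      cplus_transpose_mul_cminus, cminus_transpose_mul_cplus]
    module
  have h2 : IsUnit (cminus Y)ᵀ.det := by rw [det_transpose]; exact hY.isUnit_det.1
  have h3 : (-(2 * Complex.I)) • (wronskian Y Yh).map Complex.ofReal =
      ((-(2 * Complex.I)) • (1 : Matrix (Fin n) (Fin n) ℂ)) *
        (wronskian Y Yh).map Complex.ofReal := by
    rw [Matrix.smul_mul, Matrix.one_mul]
  have h4 : IsUnit ((-(2 * Complex.I)) • (1 : Matrix (Fin n) (Fin n) ℂ)).det := by
    rw [det_smul, det_one, mul_one, isUnit_iff_ne_zero]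
    exact pow_ne_zero _ (neg_ne_zero.mpr (mul_ne_zero two_ne_zero Complex.I_ne_zero))
  have h5 := congrArg Matrix.rank h1
  rw [rank_mul_eq_left_of_isUnit_det _ _ hYh.isUnit_det.2, rank_mul_eq_right_of_isUnit_det _ _ h2,
    h3, rank_mul_eq_right_of_isUnit_det _ _ h4] at h5
  exact h5

/-! ### Continuity and lifting of the determinant -/

theorem continuousOn_nonsing_inv {n : ℕ} {Z : ℝ → Matrix (Fin n) (Fin n) ℂ} {s : Set ℝ}
    (hZ : ContinuousOn Z s) (h : ∀ t ∈ s, IsUnit (Z t).det) :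
    ContinuousOn (fun t => (Z t)⁻¹) s := by
  simp only [inv_def, Ring.inverse_eq_inv']
  refine ContinuousOn.smul (ContinuousOn.inv₀ ?_ fun t ht => (h t ht).ne_zero) ?_
  · exact (Continuous.matrix_det continuous_id).comp_continuousOn hZ
  · exact (Continuous.matrix_adjugate continuous_id).comp_continuousOn hZ

theorem continuous_cplus {n : ℕ} :
    Continuous (cplus : Matrix (Fin n ⊕ Fin n) (Fin n) ℝ → Matrix (Fin n) (Fin n) ℂ) := by
  refine continuous_matrix fun i j => ?_
  simp only [cplus, toRows₁, toRows₂, Matrix.add_apply, Matrix.map_apply, Matrix.smul_apply,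
    of_apply]
  fun_prop

theorem continuous_cminus {n : ℕ} :
    Continuous (cminus : Matrix (Fin n ⊕ Fin n) (Fin n) ℝ → Matrix (Fin n) (Fin n) ℂ) := by
  refine continuous_matrix fun i j => ?_
  simp only [cminus, toRows₁, toRows₂, Matrix.sub_apply, Matrix.map_apply, Matrix.smul_apply,
    of_apply]
  fun_prop

theorem continuousOn_gam {n : ℕ} {Y : ℝ → Matrix (Fin n ⊕ Fin n) (Fin n) ℝ} {s : Set ℝ}
    (hY : ContinuousOn Y s) (hL : ∀ t ∈ s, IsLagrangian (Y t)) :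
    ContinuousOn (fun t => gam (Y t)) s :=
  (continuous_cplus.comp_continuousOn hY).mul
    (continuousOn_nonsing_inv (continuous_cminus.comp_continuousOn hY)
      fun t ht => (hL t ht).isUnit_det.1)

theorem continuousOn_relUnitary {n : ℕ} {Y Yh : ℝ → Matrix (Fin n ⊕ Fin n) (Fin n) ℝ} {s : Set ℝ}
    (hY : ContinuousOn Y s) (hL : ∀ t ∈ s, IsLagrangian (Y t))
    (hYh : ContinuousOn Yh s) (hLh : ∀ t ∈ s, IsLagrangian (Yh t)) :
    ContinuousOn (fun t => relUnitary (Y t) (Yh t)) s :=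
  (continuousOn_gam hY hL).mul
    (continuous_id.matrix_conjTranspose.comp_continuousOn (continuousOn_gam hYh hLh))

theorem norm_det_of_mem_unitaryGroup {n : ℕ} {N : Matrix (Fin n) (Fin n) ℂ}
    (hN : N ∈ unitaryGroup (Fin n) ℂ) : ‖N.det‖ = 1 := by
  rw [← exp_angSum 0 hN, Complex.norm_exp_ofReal_mul_I]

/-- Path lifting for the covering ℝ → S¹, after rescaling [a, b] to the unit interval. -/
theorem exists_continuousOn_lift {g : ℝ → ℂ} {a b : ℝ} (hab : a < b)
    (hg : ContinuousOn g (Set.Icc a b)) (hn : ∀ t ∈ Set.Icc a b, ‖g t‖ = 1) :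
    ∃ α : ℝ → ℝ, ContinuousOn α (Set.Icc a b) ∧
      ∀ t ∈ Set.Icc a b, Complex.exp (α t * Complex.I) = g t := by
  have hmaps : ∀ s : unitInterval, a + (b - a) * s ∈ Set.Icc a b := fun s => by
    have h0 := s.2.1
    have h1 := s.2.2
    constructor <;> nlinarith
  let γ : C(unitInterval, Circle) :=
    ⟨fun s => ⟨g (a + (b - a) * s), mem_sphere_zero_iff_norm.mpr (hn _ (hmaps s))⟩, by
      refine Continuous.subtype_mk ?_ _
      exact hg.comp_continuous (by fun_prop) hmaps⟩
  obtain ⟨Γ, hΓ, -⟩ := Circle.isCoveringMap_exp.exists_path_lifts γ (Complex.arg (γ 0))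
    (Circle.exp_arg _).symm
  have hba : 0 < b - a := sub_pos.mpr hab
  refine ⟨fun t => Γ (Set.projIcc 0 1 zero_le_one ((t - a) / (b - a))), ?_, ?_⟩
  · refine Continuous.continuousOn ?_
    exact Γ.continuous.comp (continuous_projIcc.comp (by fun_prop))
  · intro t ht
    have h01 : (t - a) / (b - a) ∈ Set.Icc (0 : ℝ) 1 :=
      ⟨div_nonneg (by linarith [ht.1]) hba.le, (div_le_one hba).mpr (by linarith [ht.2])⟩
    have h1 := congrArg (fun z : Circle => (z : ℂ))
      (congrFun hΓ (Set.projIcc 0 1 zero_le_one ((t - a) / (b - a))))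
    simp only [Function.comp_apply, Circle.coe_exp] at h1
    rw [h1]
    change g (a + (b - a) * (Set.projIcc 0 1 zero_le_one ((t - a) / (b - a)) : ℝ)) = g t
    rw [Set.projIcc_of_mem _ h01]
    congr 1
    simp only
    field_simp
    ring

theorem exists_lift_det_gam {n : ℕ} {a b : ℝ} (hab : a < b)
    {Y : ℝ → Matrix (Fin n ⊕ Fin n) (Fin n) ℝ} (hY : IsLagrangianPath a b Y) :
    ∃ α : ℝ → ℝ, ContinuousOn α (Set.Icc a b) ∧
      ∀ t ∈ Set.Icc a b, Complex.exp (α t * Complex.I) = (gam (Y t)).det :=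
  exists_continuousOn_lift hab
    ((Continuous.matrix_det continuous_id).comp_continuousOn (continuousOn_gam hY.1 hY.2))
    fun t ht => norm_det_of_mem_unitaryGroup (hY.2 t ht).gam_mem_unitaryGroup

theorem exp_lift_relUnitary {n : ℕ} {Y Yh : Matrix (Fin n ⊕ Fin n) (Fin n) ℝ} {α β : ℝ}
    (hα : Complex.exp (α * Complex.I) = (gam Y).det)
    (hβ : Complex.exp (β * Complex.I) = (gam Yh).det) :
    Complex.exp (((α - β : ℝ) : ℂ) * Complex.I) = (relUnitary Y Yh).det := by
  rw [det_relUnitary, ← hα, ← hβ, Complex.star_def, ← Complex.exp_conj, ← Complex.exp_add]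
  congr 1
  simp
  ring

/-! ### Well-definedness of the Maslov index -/

theorem sum_telescope {p : ℕ} (h : Fin (p + 1) → ℝ) :
    ∑ k : Fin p, (h k.succ - h k.castSucc) = h (Fin.last p) - h 0 := by
  rw [Finset.sum_sub_distrib]
  have h1 := Fin.sum_univ_succ h
  have h2 := Fin.sum_univ_castSucc h
  linarith

theorem isUnit_shift_Gam_iff {n : ℕ} (Y : Matrix (Fin n ⊕ Fin n) (Fin n) ℝ)
    {Yh : Matrix (Fin n ⊕ Fin n) (Fin n) ℝ} (hYh : IsLagrangian Yh) (θ : ℝ) :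
    IsUnit (shift (Gam Y Yh) (Real.pi + θ)) ↔
      IsUnit (relUnitary Y Yh - Complex.exp (θ * Complex.I) • 1) := by
  rw [Gam_eq_neg Y hYh, shift_neg, IsUnit.neg_iff]

theorem MaslovPartition.mem_Icc {n : ℕ} {a b : ℝ}
    {Y Yh : ℝ → Matrix (Fin n ⊕ Fin n) (Fin n) ℝ} (D : MaslovPartition a b Y Yh)
    (k : Fin (D.p + 1)) : D.t k ∈ Set.Icc a b := by
  constructor
  · exact D.first.symm.le.trans (D.strictMono.monotone (Fin.zero_le k))
  · exact (D.strictMono.monotone (Fin.le_last k)).trans D.last.le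

/-- The right-hand side depends only on the end points and on a lift of the determinant. It is both
the source of well-definedness and the working formula for the index. -/
theorem MaslovPartition.two_pi_mul_sum {n : ℕ} {a b : ℝ}
    {Y Yh : ℝ → Matrix (Fin n ⊕ Fin n) (Fin n) ℝ} (hY : IsLagrangianPath a b Y)
    (hYh : IsLagrangianPath a b Yh) {α : ℝ → ℝ} (hα : ContinuousOn α (Set.Icc a b))
    (hexp : ∀ t ∈ Set.Icc a b, Complex.exp (α t * Complex.I) = (relUnitary (Y t) (Yh t)).det)
    (D : MaslovPartition a b Y Yh) :
    2 * Real.pi * (D.sum : ℝ) = (α b - α a) - (angSum 0 (relUnitary (Y b) (Yh b))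
      - angSum 0 (relUnitary (Y a) (Yh a))) := by
  have hpi := Real.pi_pos
  set h : ℝ → ℝ := fun t => α t - angSum 0 (relUnitary (Y t) (Yh t)) with hh
  have hu : ∀ t ∈ Set.Icc a b, relUnitary (Y t) (Yh t) ∈ unitaryGroup (Fin n) ℂ :=
    fun t ht => relUnitary_mem (hY.2 t ht) (hYh.2 t ht)
  have hstep : ∀ k : Fin D.p, 2 * Real.pi *
      ((ell (Gam (Y (D.t k.succ)) (Yh (D.t k.succ))) (D.ε k) : ℝ)
        - (ell (Gam (Y (D.t k.castSucc)) (Yh (D.t k.castSucc))) (D.ε k) : ℝ))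
      = h (D.t k.succ) - h (D.t k.castSucc) := by
    intro k
    have hle : D.t k.castSucc ≤ D.t k.succ := D.strictMono.monotone (Fin.castSucc_le_succ k)
    have hsub : Set.Icc (D.t k.castSucc) (D.t k.succ) ⊆ Set.Icc a b :=
      Set.Icc_subset_Icc (D.mem_Icc _).1 (D.mem_Icc _).2
    have hε : D.ε k ∈ Set.Ioo 0 (2 * Real.pi) :=
      ⟨(D.eps_mem k).1, by linarith [(D.eps_mem k).2]⟩
    have hc : ContinuousOn (fun t => angSum (D.ε k - 2 * Real.pi) (relUnitary (Y t) (Yh t)))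
        (Set.Icc (D.t k.castSucc) (D.t k.succ)) := by
      refine continuousOn_angSum ((continuousOn_relUnitary hY.1 hY.2 hYh.1 hYh.2).mono hsub)
        (fun t ht => hu t (hsub ht)) fun t ht => ?_
      rw [exp_sub_two_pi_mul_I, ← isUnit_shift_Gam_iff _ (hYh.2 t (hsub ht))]
      exact (D.regular k t ht).1
    -- On this piece the angle sum with cut at ε and α are two continuous lifts of the same
    -- determinant.
    have heq := eq_of_exp_eq_of_continuousOn (w := 1) hle (hc.sub (hα.mono hsub)) fun t ht => by
      rw [Pi.sub_apply]
      push_cast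
      rw [sub_mul, Complex.exp_sub, exp_angSum _ (hu t (hsub ht)), hexp t (hsub ht), div_self]
      rw [← hexp t (hsub ht)]
      exact Complex.exp_ne_zero _
    simp only [Pi.sub_apply] at heq
    rw [angSum_sub_two_pi (hu _ (D.mem_Icc _)) hε, angSum_sub_two_pi (hu _ (D.mem_Icc _)) hε,
      ← Gam_eq_neg _ (hYh.2 _ (D.mem_Icc _)), ← Gam_eq_neg _ (hYh.2 _ (D.mem_Icc _))] at heq
    rw [hh]
    linear_combination -heq
  have htel := sum_telescope fun k => h (D.t k)
  rw [← Finset.sum_congr rfl fun k _ => hstep k, ← Finset.mul_sum, D.last, D.first] at htel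
  rw [MaslovPartition.sum]
  push_cast
  rw [htel, hh]
  ring

/-- Near each point some ε avoids the finitely many eigenvalues, and keeps doing so nearby because
invertibility is open. A Lebesgue number of this cover bounds the mesh of an equidistant partition.
-/
theorem nonempty_maslovPartition {n : ℕ} {a b : ℝ} (hab : a < b)
    {Y Yh : ℝ → Matrix (Fin n ⊕ Fin n) (Fin n) ℝ} (hY : IsLagrangianPath a b Y)
    (hYh : IsLagrangianPath a b Yh) : Nonempty (MaslovPartition a b Y Yh) := by
  have hpi := Real.pi_pos
  have hu : ∀ t ∈ Set.Icc a b, relUnitary (Y t) (Yh t) ∈ unitaryGroup (Fin n) ℂ :=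
    fun t ht => relUnitary_mem (hY.2 t ht) (hYh.2 t ht)
  have hcont := continuousOn_relUnitary hY.1 hY.2 hYh.1 hYh.2
  have hloc : ∀ t₀ : Set.Icc a b, ∃ O : Set ℝ, IsOpen O ∧ (t₀ : ℝ) ∈ O ∧
      ∃ ε ∈ Set.Ioo 0 Real.pi, ∀ t ∈ O ∩ Set.Icc a b,
        IsUnit (shift (Gam (Y t) (Yh t)) (Real.pi + ε)) ∧
        IsUnit (shift (Gam (Y t) (Yh t)) (Real.pi - ε)) := by
    rintro ⟨t₀, ht₀⟩
    obtain ⟨P, hP, d, hd, hN⟩ := exists_unitary_diagonalization (hu t₀ ht₀)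
    -- The first finite set keeps e^{iε} out of the spectrum of N, the second keeps e^{-iε} out.
    obtain ⟨ε, hε, hεd⟩ := (Set.Ioo_infinite hpi).exists_notMem_finset
      ((Finset.univ.image fun i => ang 0 (d i)) ∪ (Finset.univ.image fun i => -ang (-Real.pi) (d i)))
    simp only [Finset.mem_union, Finset.mem_image, Finset.mem_univ, true_and, not_or,
      not_exists] at hεd
    have h1 : IsUnit (relUnitary (Y t₀) (Yh t₀) - Complex.exp ((ε : ℝ) * Complex.I) • 1) := by
      rw [hN, isUnit_diagonalization_sub_iff hP]
      intro i hi
      exact hεd.1 i ((ang_eq_iff ⟨hε.1.le, by linarith [hε.2]⟩ (hd i)).mpr hi)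
    have h2 : IsUnit (relUnitary (Y t₀) (Yh t₀) -
        Complex.exp (((-ε : ℝ) : ℂ) * Complex.I) • 1) := by
      rw [hN, isUnit_diagonalization_sub_iff hP]
      intro i hi
      refine hεd.2 i (neg_eq_iff_eq_neg.mpr ((ang_eq_iff ⟨?_, ?_⟩ (hd i)).mpr hi))
      · linarith [hε.2]
      · linarith [hε.1]
    have hev : ∀ᶠ t in nhdsWithin t₀ (Set.Icc a b),
        IsUnit (shift (Gam (Y t) (Yh t)) (Real.pi + ε)) ∧
        IsUnit (shift (Gam (Y t) (Yh t)) (Real.pi - ε)) := by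
      filter_upwards [self_mem_nhdsWithin,
        isUnit_nhdsWithin (N := fun t => relUnitary (Y t) (Yh t) - _)
          ((hcont t₀ ht₀).sub continuousWithinAt_const) h1,
        isUnit_nhdsWithin (N := fun t => relUnitary (Y t) (Yh t) - _)
          ((hcont t₀ ht₀).sub continuousWithinAt_const) h2] with t ht h3 h4
      rw [sub_eq_add_neg Real.pi, isUnit_shift_Gam_iff _ (hYh.2 t ht),
        isUnit_shift_Gam_iff _ (hYh.2 t ht)]
      exact ⟨h3, h4⟩
    obtain ⟨O, hO, hmem, hsub⟩ := mem_nhdsWithin.mp hev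
    exact ⟨O, hO, hmem, ε, hε, fun t ht => hsub ht⟩
  choose O hO hmem ε hε hreg using hloc
  obtain ⟨δ, hδ, hball⟩ := lebesgue_number_lemma_of_metric isCompact_Icc hO
    (fun t ht => Set.mem_iUnion.mpr ⟨⟨t, ht⟩, hmem ⟨t, ht⟩⟩)
  have hba : 0 < b - a := sub_pos.mpr hab
  obtain ⟨m, hm⟩ := exists_nat_gt ((b - a) / δ)
  have hm0 : (0 : ℝ) < m := (div_pos hba hδ).trans hm
  have hstep : (b - a) / m < δ := by
    rw [div_lt_iff₀ hm0]
    rw [div_lt_iff₀ hδ] at hm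
    linarith
  set t : Fin (m + 1) → ℝ := fun k => a + k * ((b - a) / m) with ht
  have hs0 : 0 < (b - a) / m := div_pos hba hm0
  have htmem : ∀ k, t k ∈ Set.Icc a b := by
    intro k
    have hk : ((k : ℕ) : ℝ) ≤ m := by exact_mod_cast Fin.is_le k
    have : (m : ℝ) * ((b - a) / m) = b - a := by field_simp
    constructor
    · have : 0 ≤ ((k : ℕ) : ℝ) * ((b - a) / m) := by positivity
      rw [ht]; simp only; linarith
    · have := mul_le_mul_of_nonneg_right hk hs0.le
      rw [ht]; simp only; linarith
  -- The number ε of each piece comes from the ball about its left end point; the mesh is below δ,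
  -- so the piece lies in that ball.
  choose c hc using fun k => hball (t k) (htmem k)
  refine ⟨⟨m, t, fun k => ε (c k.castSucc), ?_, ?_, ?_, fun k => hε _, ?_⟩⟩
  · intro i j hij
    have : ((i : ℕ) : ℝ) < ((j : ℕ) : ℝ) := by exact_mod_cast hij
    have := mul_lt_mul_of_pos_right this hs0
    rw [ht]; simp only; linarith
  · simp [ht]
  · rw [ht]
    simp only [Fin.val_last]
    field_simp
    ring
  · intro k s hs
    refine hreg (c k.castSucc) s ⟨hc k.castSucc ?_, ?_⟩
    · have : t k.succ = t k.castSucc + (b - a) / m := by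
        simp only [ht, Fin.val_succ, Fin.val_castSucc]
        push_cast
        ring
      rw [Metric.mem_ball, Real.dist_eq, abs_of_nonneg (by linarith [hs.1])]
      linarith [hs.2]
    · exact ⟨(htmem _).1.trans hs.1, hs.2.trans (htmem _).2⟩

theorem maslovWellDefined_of_isLagrangianPath {n : ℕ} {a b : ℝ} (hab : a < b)
    {Y Yh : ℝ → Matrix (Fin n ⊕ Fin n) (Fin n) ℝ} (hY : IsLagrangianPath a b Y)
    (hYh : IsLagrangianPath a b Yh) : MaslovWellDefined a b Y Yh := by
  have hne := nonempty_maslovPartition hab hY hYh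
  refine ⟨hne, fun D => ?_⟩
  rw [maslovIndex, dif_pos hne]
  obtain ⟨α, hα, hαe⟩ := exists_lift_det_gam hab hY
  obtain ⟨β, hβ, hβe⟩ := exists_lift_det_gam hab hYh
  have h := fun D : MaslovPartition a b Y Yh => D.two_pi_mul_sum hY hYh (hα.sub hβ)
    fun t ht => exp_lift_relUnitary (hαe t ht) (hβe t ht)
  have h1 := (h D).trans (h hne.some).symm
  exact_mod_cast mul_left_cancel₀ Real.two_pi_pos.ne' h1

theorem two_pi_mul_maslovIndex {n : ℕ} {a b : ℝ} (hab : a < b)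
    {Y Yh : ℝ → Matrix (Fin n ⊕ Fin n) (Fin n) ℝ} (hY : IsLagrangianPath a b Y)
    (hYh : IsLagrangianPath a b Yh) {α : ℝ → ℝ} (hα : ContinuousOn α (Set.Icc a b))
    (hexp : ∀ t ∈ Set.Icc a b, Complex.exp (α t * Complex.I) = (relUnitary (Y t) (Yh t)).det) :
    2 * Real.pi * (maslovIndex a b Y Yh : ℝ) = (α b - α a) -
      (angSum 0 (relUnitary (Y b) (Yh b)) - angSum 0 (relUnitary (Y a) (Yh a))) := by
  have hne := nonempty_maslovPartition hab hY hYh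
  rw [maslovIndex, dif_pos hne]
  exact hne.some.two_pi_mul_sum hY hYh hα hexp

/-! ### Negative index and inertia -/

section Inertia

variable {𝕜 : Type*} [RCLike 𝕜] {n : ℕ}

/-- The quadratic form of a matrix. -/
def quadForm (A : Matrix (Fin n) (Fin n) 𝕜) (x : Fin n → 𝕜) : ℝ :=
  RCLike.re (star x ⬝ᵥ A *ᵥ x)

theorem quadForm_congruence (R : Matrix (Fin n) (Fin n) 𝕜) (e : Fin n → ℝ) (x : Fin n → 𝕜) :
    quadForm (Rᴴ * diagonal (fun i => (e i : 𝕜)) * R) x = ∑ i, e i * ‖(R *ᵥ x) i‖ ^ 2 := by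
  rw [quadForm, ← mulVec_mulVec, ← mulVec_mulVec, dotProduct_mulVec, ← star_mulVec, dotProduct,
    map_sum]
  refine Finset.sum_congr rfl fun i _ => ?_
  rw [mulVec_diagonal, Pi.star_apply, mul_left_comm, RCLike.star_def, RCLike.conj_mul]
  norm_cast

/-- The vectors whose image under `R` vanishes at the coordinates satisfying `p`. -/
def coordKer (R : Matrix (Fin n) (Fin n) 𝕜) (p : Fin n → Prop) : Submodule 𝕜 (Fin n → 𝕜) where
  carrier := {x | ∀ i, p i → (R *ᵥ x) i = 0}
  add_mem' hx hy i hi := by rw [mulVec_add, Pi.add_apply, hx i hi, hy i hi, add_zero]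
  zero_mem' i _ := by simp
  smul_mem' c x hx i hi := by rw [mulVec_smul, Pi.smul_apply, hx i hi, smul_zero]

theorem finrank_coordKer {R : Matrix (Fin n) (Fin n) 𝕜} (hR : IsUnit R) (p : Fin n → Prop)
    [DecidablePred p] :
    Module.finrank 𝕜 (coordKer R p) = (Finset.univ.filter fun i => ¬ p i).card := by
  set L : (Fin n → 𝕜) →ₗ[𝕜] ({i // p i} → 𝕜) :=
    (LinearMap.funLeft 𝕜 𝕜 (Subtype.val : {i // p i} → Fin n)) ∘ₗ R.mulVecLin with hL
  have hker : LinearMap.ker L = coordKer R p := by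
    ext x
    rw [LinearMap.mem_ker]
    refine ⟨fun h i hi => congrFun h ⟨i, hi⟩, fun h => ?_⟩
    funext i
    exact h i.1 i.2
  have hsurj : Function.Surjective L :=
    (LinearMap.funLeft_surjective_of_injective 𝕜 𝕜 _ Subtype.val_injective).comp
      (mulVec_surjective_iff_isUnit.mpr hR)
  have h1 := LinearMap.finrank_range_add_finrank_ker L
  rw [LinearMap.range_eq_top.mpr hsurj, finrank_top, Module.finrank_fintype_fun_eq_card,
    Module.finrank_fin_fun, hker, ← Nat.card_eq_fintype_card] at h1
  have h3 : Nat.card {i // p i} = (Finset.univ.filter p).card := by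
    rw [Nat.card_eq_fintype_card, Fintype.card_subtype]
  have h2 := Finset.card_filter_add_card_filter_not (s := (Finset.univ : Finset (Fin n))) (p := p)
  rw [Finset.card_univ, Fintype.card_fin] at h2
  omega

theorem quadForm_nonneg_of_mem_coordKer (R : Matrix (Fin n) (Fin n) 𝕜) (e : Fin n → ℝ)
    {x : Fin n → 𝕜} (hx : x ∈ coordKer R fun i => e i < 0) :
    0 ≤ quadForm (Rᴴ * diagonal (fun i => (e i : 𝕜)) * R) x := by
  rw [quadForm_congruence]
  refine Finset.sum_nonneg fun i _ => ?_
  by_cases h : e i < 0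
  · rw [hx i h]; simp
  · exact mul_nonneg (not_lt.mp h) (by positivity)

theorem quadForm_neg_of_mem_coordKer {R : Matrix (Fin n) (Fin n) 𝕜} (hR : IsUnit R)
    (e : Fin n → ℝ) {x : Fin n → 𝕜} (hx : x ∈ coordKer R fun i => ¬ e i < 0) (hx0 : x ≠ 0) :
    quadForm (Rᴴ * diagonal (fun i => (e i : 𝕜)) * R) x < 0 := by
  rw [quadForm_congruence]
  have hne : R *ᵥ x ≠ 0 := by
    intro h
    exact hx0 (mulVec_injective_iff_isUnit.mpr hR (h.trans (mulVec_zero R).symm))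
  obtain ⟨j, hj⟩ := Function.ne_iff.mp hne
  have hj' : e j < 0 := by
    by_contra h
    exact hj (hx j h)
  refine Finset.sum_neg' (fun i _ => ?_) ⟨j, Finset.mem_univ j, ?_⟩
  · by_cases h : e i < 0
    · exact mul_nonpos_of_nonpos_of_nonneg h.le (by positivity)
    · rw [hx i h]; simp
  · have : 0 < ‖(R *ᵥ x) j‖ := norm_pos_iff.mpr hj
    exact mul_neg_of_neg_of_pos hj' (by positivity)

/-- A negative definite subspace meets trivially the subspace where the coordinates with e i < 0
vanish, on which the form is nonnegative and whose codimension is the number of such coordinates. -/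
theorem finrank_le_of_quadForm_neg {R : Matrix (Fin n) (Fin n) 𝕜} (hR : IsUnit R)
    (e : Fin n → ℝ) {N : Submodule 𝕜 (Fin n → 𝕜)}
    (hN : ∀ x ∈ N, x ≠ 0 → quadForm (Rᴴ * diagonal (fun i => (e i : 𝕜)) * R) x < 0) :
    Module.finrank 𝕜 N ≤ (Finset.univ.filter fun i => e i < 0).card := by
  have hd : Disjoint N (coordKer R fun i => e i < 0) := by
    rw [Submodule.disjoint_def]
    intro x hx hx'
    by_contra h0
    exact absurd (hN x hx h0) (not_lt.mpr (quadForm_nonneg_of_mem_coordKer R e hx'))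
  have h1 := Submodule.finrank_add_finrank_le_of_disjoint hd
  rw [finrank_coordKer hR, Module.finrank_fin_fun] at h1
  have h2 := Finset.card_filter_add_card_filter_not (s := (Finset.univ : Finset (Fin n)))
    (p := fun i => e i < 0)
  rw [Finset.card_univ, Fintype.card_fin] at h2
  omega

theorem finrank_le_of_quadForm_nonneg {R : Matrix (Fin n) (Fin n) 𝕜} (hR : IsUnit R)
    (e : Fin n → ℝ) {N : Submodule 𝕜 (Fin n → 𝕜)}
    (hN : ∀ x ∈ N, 0 ≤ quadForm (Rᴴ * diagonal (fun i => (e i : 𝕜)) * R) x) :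
    Module.finrank 𝕜 N + (Finset.univ.filter fun i => e i < 0).card ≤ n := by
  have hd : Disjoint N (coordKer R fun i => ¬ e i < 0) := by
    rw [Submodule.disjoint_def]
    intro x hx hx'
    by_contra h0
    exact absurd (hN x hx) (not_le.mpr (quadForm_neg_of_mem_coordKer hR e hx' h0))
  have h1 := Submodule.finrank_add_finrank_le_of_disjoint hd
  rw [finrank_coordKer hR, Module.finrank_fin_fun] at h1
  simpa using h1

theorem card_neg_le_of_congruence {R S : Matrix (Fin n) (Fin n) 𝕜} (hR : IsUnit R) (hS : IsUnit S)
    {e f : Fin n → ℝ} (h : Rᴴ * diagonal (fun i => (e i : 𝕜)) * R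
      = Sᴴ * diagonal (fun i => (f i : 𝕜)) * S) :
    (Finset.univ.filter fun i => e i < 0).card ≤ (Finset.univ.filter fun i => f i < 0).card := by
  have h1 := finrank_le_of_quadForm_neg hS f (N := coordKer R fun i => ¬ e i < 0) fun x hx hx0 => by
    rw [← h]; exact quadForm_neg_of_mem_coordKer hR e hx hx0
  rw [finrank_coordKer hR] at h1
  simpa using h1

/-- Sylvester's law of inertia. -/
theorem card_neg_eq_of_congruence {R S : Matrix (Fin n) (Fin n) 𝕜} (hR : IsUnit R) (hS : IsUnit S)
    {e f : Fin n → ℝ} (h : Rᴴ * diagonal (fun i => (e i : 𝕜)) * R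
      = Sᴴ * diagonal (fun i => (f i : 𝕜)) * S) :
    (Finset.univ.filter fun i => e i < 0).card = (Finset.univ.filter fun i => f i < 0).card :=
  le_antisymm (card_neg_le_of_congruence hR hS h) (card_neg_le_of_congruence hS hR h.symm)

end Inertia

/-! ### Variational descriptions of the negative index of a real symmetric matrix -/

theorem exists_diagonalization_of_symm {n : ℕ} {A : Matrix (Fin n) (Fin n) ℝ} (hA : Aᵀ = A) :
    ∃ R : Matrix (Fin n) (Fin n) ℝ, IsUnit R ∧ ∃ e : Fin n → ℝ,
      A = Rᴴ * diagonal (fun i => ((e i : ℝ) : ℝ)) * R ∧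
      negIndex A = (Finset.univ.filter fun i => e i < 0).card := by
  have hH : A.IsHermitian := by
    rw [IsHermitian, conjTranspose_eq_transpose_of_trivial, hA]
  refine ⟨(hH.eigenvectorUnitary : Matrix (Fin n) (Fin n) ℝ)ᴴ, ?_, hH.eigenvalues, ?_, ?_⟩
  · have h := hH.eigenvectorUnitary.2
    exact ⟨⟨_, _, mem_unitaryGroup_iff'.mp h, mem_unitaryGroup_iff.mp h⟩, rfl⟩
  · have := hH.spectral_theorem
    rw [Unitary.conjStarAlgAut_apply, star_eq_conjTranspose] at this
    rw [conjTranspose_conjTranspose]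
    exact this
  · rw [negIndex, hH.roots_charpoly_eq_eigenvalues, Multiset.filter_map, Multiset.card_map]
    rfl

/-- The negative index of a real symmetric matrix can be read off from a complex congruence. -/
theorem negIndex_eq_of_complex_congruence {n : ℕ} {A : Matrix (Fin n) (Fin n) ℝ} (hA : Aᵀ = A)
    {S : Matrix (Fin n) (Fin n) ℂ} (hS : IsUnit S) {f : Fin n → ℝ}
    (h : A.map Complex.ofReal = Sᴴ * diagonal (fun i => (f i : ℂ)) * S) :
    negIndex A = (Finset.univ.filter fun i => f i < 0).card := by
  obtain ⟨R, hR, e, hAe, hneg⟩ := exists_diagonalization_of_symm hA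
  rw [hneg]
  refine card_neg_eq_of_congruence (isUnit_map_ofReal hR) hS ?_
  rw [RCLike.ofReal_eq_complex_ofReal] at *
  rw [← h, hAe, map_ofReal_mul, map_ofReal_mul, map_ofReal_conjTranspose,
    conjTranspose_eq_transpose_of_trivial, diagonal_map (by simp)]

theorem quadForm_real {n : ℕ} (A : Matrix (Fin n) (Fin n) ℝ) (x : Fin n → ℝ) :
    quadForm A x = x ⬝ᵥ A *ᵥ x := by
  simp [quadForm]

theorem le_negIndex {n : ℕ} {A : Matrix (Fin n) (Fin n) ℝ} (hA : Aᵀ = A)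
    {N : Submodule ℝ (Fin n → ℝ)} (hN : ∀ x ∈ N, x ≠ 0 → x ⬝ᵥ A *ᵥ x < 0) :
    Module.finrank ℝ N ≤ negIndex A := by
  obtain ⟨R, hR, e, hAe, hneg⟩ := exists_diagonalization_of_symm hA
  rw [hneg]
  refine finrank_le_of_quadForm_neg hR e fun x hx hx0 => ?_
  have := hN x hx hx0
  rw [← quadForm_real, hAe] at this
  exact this

theorem finrank_add_negIndex_le {n : ℕ} {A : Matrix (Fin n) (Fin n) ℝ} (hA : Aᵀ = A)
    {N : Submodule ℝ (Fin n → ℝ)} (hN : ∀ x ∈ N, 0 ≤ x ⬝ᵥ A *ᵥ x) :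
    Module.finrank ℝ N + negIndex A ≤ n := by
  obtain ⟨R, hR, e, hAe, hneg⟩ := exists_diagonalization_of_symm hA
  rw [hneg]
  refine finrank_le_of_quadForm_nonneg hR e fun x hx => ?_
  have := hN x hx
  rw [← quadForm_real, hAe] at this
  exact this

theorem exists_neg_subspace {n : ℕ} {A : Matrix (Fin n) (Fin n) ℝ} (hA : Aᵀ = A) :
    ∃ N : Submodule ℝ (Fin n → ℝ), Module.finrank ℝ N = negIndex A ∧
      ∀ x ∈ N, x ≠ 0 → x ⬝ᵥ A *ᵥ x < 0 := by
  obtain ⟨R, hR, e, hAe, hneg⟩ := exists_diagonalization_of_symm hA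
  refine ⟨coordKer R fun i => ¬ e i < 0, ?_, fun x hx hx0 => ?_⟩
  · rw [finrank_coordKer hR, hneg]; simp
  · have := quadForm_neg_of_mem_coordKer hR e hx hx0
    rw [← quadForm_real, hAe]
    exact this

theorem exists_nonneg_subspace {n : ℕ} {A : Matrix (Fin n) (Fin n) ℝ} (hA : Aᵀ = A) :
    ∃ N : Submodule ℝ (Fin n → ℝ), Module.finrank ℝ N + negIndex A = n ∧
      ∀ x ∈ N, 0 ≤ x ⬝ᵥ A *ᵥ x := by
  obtain ⟨R, hR, e, hAe, hneg⟩ := exists_diagonalization_of_symm hA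
  refine ⟨coordKer R fun i => e i < 0, ?_, fun x hx => ?_⟩
  · rw [finrank_coordKer hR, hneg, add_comm]
    simpa using Finset.card_filter_add_card_filter_not (s := (Finset.univ : Finset (Fin n)))
      (p := fun i => e i < 0)
  · have := quadForm_nonneg_of_mem_coordKer R e hx
    rw [← quadForm_real, hAe]
    exact this

/-! ### Singular perturbation of the negative index -/

theorem dotProduct_pencil {n : ℕ} (A B C : Matrix (Fin n) (Fin n) ℝ) (t : ℝ) (x : Fin n → ℝ) :
    x ⬝ᵥ (A + t • C - t⁻¹ • B) *ᵥ x
      = x ⬝ᵥ A *ᵥ x + t * (x ⬝ᵥ C *ᵥ x) - t⁻¹ * (x ⬝ᵥ B *ᵥ x) := by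
  simp [sub_mulVec, add_mulVec, smul_mulVec, dotProduct_add, dotProduct_sub]

theorem dotProduct_smul_mulVec_smul {n : ℕ} (A : Matrix (Fin n) (Fin n) ℝ) (c : ℝ)
    (x : Fin n → ℝ) : (c • x) ⬝ᵥ A *ᵥ (c • x) = c ^ 2 * (x ⬝ᵥ A *ᵥ x) := by
  simp only [mulVec_smul, dotProduct_smul, smul_dotProduct, smul_eq_mul]
  ring

/-- On a subspace where `A` is negative on the kernel of `B`, the pencil `A + t C - t⁻¹ B` is
eventually negative. -/
theorem exists_pencil_neg {n : ℕ} {A B C : Matrix (Fin n) (Fin n) ℝ}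
    (hB : ∀ x : Fin n → ℝ, 0 ≤ x ⬝ᵥ B *ᵥ x) (hB0 : ∀ x : Fin n → ℝ, x ⬝ᵥ B *ᵥ x = 0 → B *ᵥ x = 0)
    (hC : ∀ x : Fin n → ℝ, 0 ≤ x ⬝ᵥ C *ᵥ x) {N : Submodule ℝ (Fin n → ℝ)}
    (hN : ∀ x ∈ N, x ≠ 0 → B *ᵥ x = 0 → x ⬝ᵥ A *ᵥ x < 0) :
    ∃ t₀ > (0 : ℝ), ∀ t ∈ Set.Ioo 0 t₀, ∀ x ∈ N, x ≠ 0 → x ⬝ᵥ (A + t • C - t⁻¹ • B) *ᵥ x < 0 := by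
  set g : ℝ → (Fin n → ℝ) → ℝ := fun t x => x ⬝ᵥ (A + t • C - t⁻¹ • B) *ᵥ x with hg
  have hmono : ∀ {s t : ℝ}, 0 < s → s ≤ t → ∀ x, g s x ≤ g t x := by
    intro s t hs hst x
    simp only [hg, dotProduct_pencil]
    have h1 := mul_le_mul_of_nonneg_right hst (hC x)
    have h2 := mul_le_mul_of_nonneg_right (inv_anti₀ hs hst) (hB x)
    linarith
  -- The values increase with t since B, C ≥ 0. If the conclusion failed, the nonempty compact sets
  -- `F m` on the unit sphere of N would decrease to a common point x, at which the form is
  -- nonnegative for every t = 1/(m + 1).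
  have hcont : ∀ M : Matrix (Fin n) (Fin n) ℝ, Continuous fun x : Fin n → ℝ => x ⬝ᵥ M *ᵥ x :=
    fun M => Continuous.dotProduct continuous_id (Continuous.matrix_mulVec continuous_const
      continuous_id)
  set F : ℕ → Set (Fin n → ℝ) := fun m =>
    {x | 0 ≤ g ((m : ℝ) + 1)⁻¹ x} ∩ ((N : Set (Fin n → ℝ)) ∩ Metric.sphere 0 1) with hF
  have hclosed : ∀ m, IsClosed (F m) := fun m =>
    (isClosed_le continuous_const (hcont _)).inter
      ((Submodule.closed_of_finiteDimensional N).inter Metric.isClosed_sphere)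
  have hanti : ∀ m, F (m + 1) ⊆ F m := by
    rintro m x ⟨hx, hx'⟩
    refine ⟨le_trans hx (hmono (by positivity) (inv_anti₀ (by positivity) ?_) x), hx'⟩
    push_cast
    linarith
  have hempty : ∃ m, F m = ∅ := by
    by_contra hne
    push Not at hne
    obtain ⟨x, hx⟩ := IsCompact.nonempty_iInter_of_sequence_nonempty_isCompact_isClosed F hanti
      hne (((isCompact_sphere 0 1).of_isClosed_subset (hclosed 0)
        fun x hx => hx.2.2)) hclosed
    rw [Set.mem_iInter] at hx
    have hxN : x ∈ N := (hx 0).2.1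
    have hx0 : x ≠ 0 := by
      rintro rfl
      have := (hx 0).2.2
      simp at this
    have hlim : Filter.Tendsto (fun m : ℕ => ((m : ℝ) + 1)⁻¹) Filter.atTop (nhds 0) := by
      simpa using tendsto_one_div_add_atTop_nhds_zero_nat (𝕜 := ℝ)
    have hle : ∀ m : ℕ, 0 ≤ x ⬝ᵥ A *ᵥ x + ((m : ℝ) + 1)⁻¹ * (x ⬝ᵥ C *ᵥ x)
        - ((m : ℝ) + 1) * (x ⬝ᵥ B *ᵥ x) := by
      intro m
      have := (hx m).1
      simpa only [hg, Set.mem_ofPred_eq, dotProduct_pencil, inv_inv] using this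
    -- Dividing by m + 1 and passing to the limit gives x·Bx ≤ 0. The B-term then vanishes for every
    -- m, and a second limit gives x·Ax ≥ 0, against the hypothesis on N.
    have hBx : B *ᵥ x = 0 := by
      refine hB0 x (le_antisymm ?_ (hB x))
      have h1 : Filter.Tendsto (fun m : ℕ => ((m : ℝ) + 1)⁻¹ *
          (x ⬝ᵥ A *ᵥ x + ((m : ℝ) + 1)⁻¹ * (x ⬝ᵥ C *ᵥ x))) Filter.atTop (nhds 0) := by
        simpa using hlim.mul ((hlim.mul_const (x ⬝ᵥ C *ᵥ x)).const_add (x ⬝ᵥ A *ᵥ x))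
      refine ge_of_tendsto' h1 fun m => ?_
      have hm : (0 : ℝ) < (m : ℝ) + 1 := by positivity
      rw [inv_mul_eq_div, le_div_iff₀ hm]
      linarith [hle m]
    have h2 : Filter.Tendsto (fun m : ℕ => x ⬝ᵥ A *ᵥ x + ((m : ℝ) + 1)⁻¹ * (x ⬝ᵥ C *ᵥ x))
        Filter.atTop (nhds (x ⬝ᵥ A *ᵥ x)) := by
      simpa using (hlim.mul_const (x ⬝ᵥ C *ᵥ x)).const_add (x ⬝ᵥ A *ᵥ x)
    have h3 : 0 ≤ x ⬝ᵥ A *ᵥ x := by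
      refine ge_of_tendsto' h2 fun m => ?_
      have := hle m
      rw [hBx, dotProduct_zero, mul_zero, sub_zero] at this
      exact this
    exact absurd (hN x hxN hx0 hBx) (not_lt.mpr h3)
  obtain ⟨m, hm⟩ := hempty
  refine ⟨((m : ℝ) + 1)⁻¹, by positivity, fun t ht x hxN hx0 => ?_⟩
  refine lt_of_le_of_lt (hmono ht.1 ht.2.le x) ?_
  by_contra hge
  have hnx : 0 < ‖x‖ := norm_pos_iff.mpr hx0
  have : ‖x‖⁻¹ • x ∈ F m := by
    refine ⟨?_, N.smul_mem _ hxN, ?_⟩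
    · simp only [hg, Set.mem_ofPred_eq, dotProduct_smul_mulVec_smul]
      exact mul_nonneg (by positivity) (not_lt.mp hge)
    · rw [mem_sphere_zero_iff_norm, norm_smul, norm_inv, norm_norm, inv_mul_cancel₀ hnx.ne']
  rw [hm] at this
  exact this

/-- The hypotheses make V the orthogonal projection onto ker B. For small t the term -t⁻¹B makes a
complement of ker B negative, contributing rank B, while on ker B only A matters, tC being a
nonnegative perturbation that vanishes in the limit. -/
theorem negIndex_pencil {n : ℕ} {A B C V : Matrix (Fin n) (Fin n) ℝ} (hA : Aᵀ = A) (hBt : Bᵀ = B)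
    (hCt : Cᵀ = C) (hB : ∀ x : Fin n → ℝ, 0 ≤ x ⬝ᵥ B *ᵥ x)
    (hB0 : ∀ x : Fin n → ℝ, x ⬝ᵥ B *ᵥ x = 0 → B *ᵥ x = 0)
    (hC : ∀ x : Fin n → ℝ, 0 ≤ x ⬝ᵥ C *ᵥ x) (hV : Vᵀ = V) (hBV : B * V = 0)
    (hVB : ∀ x, B *ᵥ x = 0 → V *ᵥ x = x) :
    ∃ t₀ > (0 : ℝ), ∀ t ∈ Set.Ioo 0 t₀,
      negIndex (A + t • C - t⁻¹ • B) = B.rank + negIndex (V * A * V) := by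
  have hsymm : ∀ t : ℝ, (A + t • C - t⁻¹ • B)ᵀ = A + t • C - t⁻¹ • B := by
    intro t; simp [hA, hBt, hCt]
  have hVAV : (V * A * V)ᵀ = V * A * V := by
    rw [transpose_mul, transpose_mul, hV, hA, Matrix.mul_assoc]
  have hform : ∀ x : Fin n → ℝ, x ⬝ᵥ (V * A * V) *ᵥ x = (V *ᵥ x) ⬝ᵥ A *ᵥ (V *ᵥ x) := by
    intro x
    rw [← mulVec_mulVec, ← mulVec_mulVec, dotProduct_mulVec, ← mulVec_transpose, hV]
  have hBVx : ∀ x, B *ᵥ (V *ᵥ x) = 0 := by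
    intro x; rw [mulVec_mulVec, hBV, zero_mulVec]
  set K := LinearMap.ker B.mulVecLin with hK
  set W := LinearMap.ker V.mulVecLin with hW
  have hKmem : ∀ x, x ∈ K ↔ B *ᵥ x = 0 := fun x => by rw [hK, LinearMap.mem_ker, mulVecLin_apply]
  have hWmem : ∀ x, x ∈ W ↔ V *ᵥ x = 0 := fun x => by rw [hW, LinearMap.mem_ker, mulVecLin_apply]
  have hrange : LinearMap.range V.mulVecLin = K := by
    ext x
    rw [LinearMap.mem_range, hKmem]
    constructor
    · rintro ⟨y, rfl⟩; exact hBVx y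
    · intro h; exact ⟨x, hVB x h⟩
  have hdimK : B.rank + Module.finrank ℝ K = n := by
    have := LinearMap.finrank_range_add_finrank_ker B.mulVecLin
    rwa [Module.finrank_fin_fun] at this
  have hdimW : Module.finrank ℝ K + Module.finrank ℝ W = n := by
    have := LinearMap.finrank_range_add_finrank_ker V.mulVecLin
    rwa [Module.finrank_fin_fun, hrange] at this
  obtain ⟨N₀, hN₀dim, hN₀⟩ := exists_neg_subspace hVAV
  obtain ⟨N₁, hN₁dim, hN₁⟩ := exists_nonneg_subspace hVAV
  set N₀' := N₀.map V.mulVecLin with hN₀'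
  have hinj : LinearMap.ker (V.mulVecLin.domRestrict N₀) = ⊥ := by
    rw [LinearMap.ker_eq_bot']
    rintro ⟨x, hx⟩ h
    have h' : V *ᵥ x = 0 := h
    by_contra hne
    have := hN₀ x hx fun h0 => hne (Subtype.ext h0)
    rw [hform, h', zero_dotProduct] at this
    exact lt_irrefl _ this
  have hN₀'dim : Module.finrank ℝ N₀' = negIndex (V * A * V) := by
    rw [← hN₀dim, hN₀', ← LinearMap.range_domRestrict]
    exact LinearMap.finrank_range_of_inj (LinearMap.ker_eq_bot.mp hinj)
  have hN₀'K : N₀' ≤ K := by rw [← hrange]; exact LinearMap.map_le_range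
  have hKW : Disjoint K W := by
    rw [Submodule.disjoint_def]
    intro x hx hx'
    rw [← hVB x ((hKmem x).mp hx)]
    exact (hWmem x).mp hx'
  have hsup : Module.finrank ℝ ↥(N₀' ⊔ W) = B.rank + negIndex (V * A * V) := by
    have h1 := Submodule.finrank_sup_add_finrank_inf_eq N₀' W
    rw [(hKW.mono_left hN₀'K).eq_bot, finrank_bot] at h1
    omega
  -- Lower bound: a maximal negative subspace of A on ker B, plus the complement ker V of ker B.
  -- Vectors of this sum that B kills lie in the first summand, where A is negative.
  obtain ⟨t₀, ht₀, hneg⟩ := exists_pencil_neg (A := A) (N := N₀' ⊔ W) hB hB0 hC (by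
    intro x hx hx0 hBx
    obtain ⟨u, hu, w, hw, rfl⟩ := Submodule.mem_sup.mp hx
    have hwK : w ∈ K := by
      have : u + w - u ∈ K := K.sub_mem ((hKmem _).mpr hBx) (hN₀'K hu)
      simpa using this
    have hw0 : w = 0 := Submodule.disjoint_def.mp hKW w hwK hw
    rw [hw0, add_zero] at hx0 ⊢
    obtain ⟨y, hy, rfl⟩ := Submodule.mem_map.mp hu
    rw [mulVecLin_apply] at hx0 ⊢
    rw [← hform]
    refine hN₀ y hy ?_
    rintro rfl
    exact hx0 (mulVec_zero V))
  refine ⟨t₀, ht₀, fun t ht => le_antisymm ?_ ?_⟩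
  -- Upper bound: on the part of ker B where A ≥ 0 the pencil equals A + tC ≥ 0, and this part has
  -- dimension at least n - rank B - ind(VAV).
  · have h1 := finrank_add_negIndex_le (hsymm t) (N := N₁ ⊓ K) (by
      rintro x ⟨hx1, hxK⟩
      have hxK' := (hKmem x).mp hxK
      have h2 := hN₁ x hx1
      rw [hform, hVB x hxK'] at h2
      rw [dotProduct_pencil, hxK', dotProduct_zero, mul_zero, sub_zero]
      exact add_nonneg h2 (mul_nonneg ht.1.le (hC x)))
    have h2 := Submodule.finrank_sup_add_finrank_inf_eq N₁ K
    have h3 := Submodule.finrank_le (N₁ ⊔ K)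
    rw [Module.finrank_fin_fun] at h3
    omega
  · rw [← hsup]
    exact le_negIndex (hsymm t) (hneg t ht)

/-! ### The triple angle sum -/

theorem isLagrangian_vertical (n : ℕ) : IsLagrangian (vertical n) := by
  constructor
  · change wronskian (vertical n) (vertical n) = 0
    rw [wronskian_eq]
    simp [vertical]
  · rw [← rank_transpose_mul_self, transpose_mul_self_eq]
    simp [vertical]

theorem wronskian_vertical {n : ℕ} (Y : Matrix (Fin n ⊕ Fin n) (Fin n) ℝ) :
    wronskian (vertical n) Y = -Y.toRows₁ := by
  rw [wronskian_eq]
  simp [vertical]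

/-- The angle sum of the triple `(E, Y, Ŷ)`. -/
def tripleAngle {n : ℕ} (Y Yh : Matrix (Fin n ⊕ Fin n) (Fin n) ℝ) : ℝ :=
  angSum 0 (relUnitary Y Yh) + angSum 0 (relUnitary (vertical n) Y)
    - angSum 0 (relUnitary (vertical n) Yh)

/-- The determinants of the three unitary matrices satisfy a cocycle relation, so the triple angle
sum lies in 2πℤ. -/
theorem exp_tripleAngle {n : ℕ} {Y Yh : Matrix (Fin n ⊕ Fin n) (Fin n) ℝ}
    (hY : IsLagrangian Y) (hYh : IsLagrangian Yh) :
    Complex.exp (tripleAngle Y Yh * Complex.I) = 1 := by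
  have hE := isLagrangian_vertical n
  have hn : ∀ {Z : Matrix (Fin n ⊕ Fin n) (Fin n) ℝ}, IsLagrangian Z →
      (gam Z).det * star (gam Z).det = 1 := fun hZ => by
    rw [mul_comm]
    exact star_mul_self_of_norm_one (norm_det_of_mem_unitaryGroup hZ.gam_mem_unitaryGroup)
  have h0 : (relUnitary (vertical n) Yh).det ≠ 0 := by
    rw [← exp_angSum 0 (relUnitary_mem hE hYh)]
    exact Complex.exp_ne_zero _
  rw [tripleAngle]
  push_cast
  rw [sub_mul, add_mul, Complex.exp_sub, Complex.exp_add, exp_angSum _ (relUnitary_mem hY hYh),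
    exp_angSum _ (relUnitary_mem hE hY), exp_angSum _ (relUnitary_mem hE hYh), div_eq_one_iff_eq h0,
    det_relUnitary, det_relUnitary, det_relUnitary]
  linear_combination (star (gam Yh).det * (gam (vertical n)).det) * hn hY

/-- Right multiplication does not change the Lagrangian plane. -/
theorem gam_mul_right {n : ℕ} {Y : Matrix (Fin n ⊕ Fin n) (Fin n) ℝ} (hY : IsLagrangian Y)
    {K : Matrix (Fin n) (Fin n) ℝ} (hYK : IsLagrangian (Y * K)) : gam (Y * K) = gam Y := by
  have h1 : cplus (Y * K) = cplus Y * K.map Complex.ofReal := by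
    have h2 : (Y * K).toRows₁ = Y.toRows₁ * K := rfl
    have h3 : (Y * K).toRows₂ = Y.toRows₂ * K := rfl
    rw [cplus, h2, h3, map_ofReal_mul, map_ofReal_mul, cplus, Matrix.add_mul, Matrix.smul_mul]
  have h4 : cminus (Y * K) = cminus Y * K.map Complex.ofReal := by
    have h2 : (Y * K).toRows₁ = Y.toRows₁ * K := rfl
    have h3 : (Y * K).toRows₂ = Y.toRows₂ * K := rfl
    rw [cminus, h2, h3, map_ofReal_mul, map_ofReal_mul, cminus, Matrix.sub_mul, Matrix.smul_mul]
  refine gam_eq_of_mul_cminus hYK ?_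
  rw [h1, h4, ← Matrix.mul_assoc, hY.gam_mul_cminus]

theorem IsLagrangian.mul_right {n : ℕ} {Y : Matrix (Fin n ⊕ Fin n) (Fin n) ℝ} (hY : IsLagrangian Y)
    {K : Matrix (Fin n) (Fin n) ℝ} (hK : IsUnit K) : IsLagrangian (Y * K) := by
  constructor
  · rw [transpose_mul]
    calc Kᵀ * Yᵀ * symJ n * (Y * K) = Kᵀ * (Yᵀ * symJ n * Y) * K := by
          simp only [Matrix.mul_assoc]
      _ = 0 := by rw [hY.1]; simp
  · rw [rank_mul_eq_left_of_isUnit_det _ _ ((isUnit_iff_isUnit_det _).mp hK), hY.2]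

/-- The rank of Y K is at most that of K, so full rank of the product forces K to be invertible. -/
theorem IsLagrangian.of_mul_right {n : ℕ} {Y : Matrix (Fin n ⊕ Fin n) (Fin n) ℝ}
    {K : Matrix (Fin n) (Fin n) ℝ} (hY : IsLagrangian (Y * K)) : IsUnit K ∧ IsLagrangian Y := by
  have hK : IsUnit K := by
    refine isUnit_of_rank_eq (le_antisymm ?_ ?_)
    · simpa using K.rank_le_card_width
    · have := rank_mul_le_right Y K
      rwa [hY.2] at this
  have hdet := (isUnit_iff_isUnit_det _).mp hK
  have h := hY.mul_right (K := K⁻¹) ((isUnit_nonsing_inv_iff).mpr hK)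
  rw [Matrix.mul_assoc, mul_nonsing_inv _ hdet, Matrix.mul_one] at h
  exact ⟨hK, h⟩

theorem tripleAngle_congr {n : ℕ} {Y Y' Z Z' : Matrix (Fin n ⊕ Fin n) (Fin n) ℝ}
    (h1 : gam Y = gam Y') (h2 : gam Z = gam Z') : tripleAngle Y Z = tripleAngle Y' Z' := by
  simp only [tripleAngle, relUnitary, h1, h2]

/-- The symplectic shear `(X, U) ↦ (X, U - Q X)`, which fixes the vertical plane. -/
def shear {n : ℕ} (Q : Matrix (Fin n) (Fin n) ℝ) (Y : Matrix (Fin n ⊕ Fin n) (Fin n) ℝ) :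
    Matrix (Fin n ⊕ Fin n) (Fin n) ℝ :=
  (fromBlocks 1 0 (-Q) 1 : Matrix (Fin n ⊕ Fin n) (Fin n ⊕ Fin n) ℝ) * Y

theorem shear_eq {n : ℕ} (Q : Matrix (Fin n) (Fin n) ℝ)
    (Y : Matrix (Fin n ⊕ Fin n) (Fin n) ℝ) :
    shear Q Y = fromRows Y.toRows₁ (Y.toRows₂ - Q * Y.toRows₁) := by
  conv_lhs => rw [shear, ← fromRows_toRows Y, fromBlocks_mul_fromRows]
  simp [sub_eq_add_neg, add_comm]

theorem wronskian_shear {n : ℕ} {Q : Matrix (Fin n) (Fin n) ℝ} (hQ : Qᵀ = Q)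
    (Y Yh : Matrix (Fin n ⊕ Fin n) (Fin n) ℝ) :
    wronskian (shear Q Y) (shear Q Yh) = wronskian Y Yh := by
  rw [wronskian_eq, wronskian_eq, shear_eq, shear_eq]
  simp only [toRows₁_fromRows, toRows₂_fromRows, transpose_sub, transpose_mul, hQ, Matrix.mul_sub,
    Matrix.sub_mul, Matrix.mul_assoc]
  abel

theorem IsLagrangian.shear {n : ℕ} {Q : Matrix (Fin n) (Fin n) ℝ} (hQ : Qᵀ = Q)
    {Y : Matrix (Fin n ⊕ Fin n) (Fin n) ℝ} (hY : IsLagrangian Y) :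
    IsLagrangian (shear Q Y) := by
  constructor
  · exact (wronskian_shear hQ Y Y).trans hY.1
  · rw [LagrangianMaslov.shear, rank_mul_eq_right_of_isUnit_det, hY.2]
    rw [det_fromBlocks_zero₁₂]
    simp

/-- Along the homotopy s ↦ sQ, 0 ≤ s ≤ 1, the shears preserve the Wronskians of all three pairs. The
multiplicities of the eigenvalue 1 are then constant, so the triple angle sum is continuous, and
being in 2πℤ it is constant. -/
theorem tripleAngle_shear {n : ℕ} {Q : Matrix (Fin n) (Fin n) ℝ} (hQ : Qᵀ = Q)
    {Y Yh : Matrix (Fin n ⊕ Fin n) (Fin n) ℝ} (hY : IsLagrangian Y) (hYh : IsLagrangian Yh) :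
    tripleAngle (shear Q Y) (shear Q Yh) = tripleAngle Y Yh := by
  have hQs : ∀ s : ℝ, (s • Q)ᵀ = s • Q := fun s => by rw [transpose_smul, hQ]
  have hc : ∀ Z : Matrix (Fin n ⊕ Fin n) (Fin n) ℝ,
      ContinuousOn (fun s : ℝ => shear (s • Q) Z) (Set.Icc 0 1) := by
    intro Z
    refine Continuous.continuousOn ?_
    refine Continuous.matrix_mul (Continuous.matrix_fromBlocks ?_ ?_ ?_ ?_) ?_ <;> fun_prop
  have hE := isLagrangian_vertical n
  have hcE : ContinuousOn (fun _ : ℝ => vertical n) (Set.Icc 0 1) := continuousOn_const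
  have hsY : ∀ s ∈ Set.Icc (0 : ℝ) 1, IsLagrangian (shear (s • Q) Y) :=
    fun s _ => hY.shear (hQs s)
  have hsYh : ∀ s ∈ Set.Icc (0 : ℝ) 1, IsLagrangian (shear (s • Q) Yh) :=
    fun s _ => hYh.shear (hQs s)
  have hvert : ∀ {Z : Matrix (Fin n ⊕ Fin n) (Fin n) ℝ} (s : ℝ),
      wronskian (vertical n) (shear (s • Q) Z) = wronskian (vertical n) Z := by
    intro Z s
    rw [wronskian_vertical, wronskian_vertical, shear_eq, toRows₁_fromRows]
  have hcont : ContinuousOn (fun s : ℝ => tripleAngle (shear (s • Q) Y) (shear (s • Q) Yh))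
      (Set.Icc 0 1) := by
    refine ContinuousOn.sub (ContinuousOn.add ?_ ?_) ?_
    · refine continuousOn_angSum_zero (r := ((wronskian Y Yh).map Complex.ofReal).rank)
        (continuousOn_relUnitary (hc Y) hsY (hc Yh) hsYh)
        (fun s hs => relUnitary_mem (hsY s hs) (hsYh s hs)) fun s hs => ?_
      rw [rank_relUnitary_sub_one (hsY s hs) (hsYh s hs), wronskian_shear (hQs s)]
    · refine continuousOn_angSum_zero (r := ((wronskian (vertical n) Y).map Complex.ofReal).rank)
        (continuousOn_relUnitary hcE (fun _ _ => hE) (hc Y) hsY)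
        (fun s hs => relUnitary_mem hE (hsY s hs)) fun s hs => ?_
      rw [rank_relUnitary_sub_one hE (hsY s hs), hvert]
    · refine continuousOn_angSum_zero (r := ((wronskian (vertical n) Yh).map Complex.ofReal).rank)
        (continuousOn_relUnitary hcE (fun _ _ => hE) (hc Yh) hsYh)
        (fun s hs => relUnitary_mem hE (hsYh s hs)) fun s hs => ?_
      rw [rank_relUnitary_sub_one hE (hsYh s hs), hvert]
  have h := eq_of_exp_eq_of_continuousOn (w := 1) zero_le_one hcont fun s hs =>
    exp_tripleAngle (hsY s hs) (hsYh s hs)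
  have h0 : ∀ Z : Matrix (Fin n ⊕ Fin n) (Fin n) ℝ, shear ((0 : ℝ) • Q) Z = Z := by
    intro Z
    rw [shear_eq, zero_smul, Matrix.zero_mul, sub_zero, fromRows_toRows]
  simp only [h0, one_smul] at h
  exact h.symm

/-- Rotation of a Lagrangian plane by the angle `-φ`. -/
def rot {n : ℕ} (φ : ℝ) (Y : Matrix (Fin n ⊕ Fin n) (Fin n) ℝ) :
    Matrix (Fin n ⊕ Fin n) (Fin n) ℝ :=
  fromRows (Real.cos φ • Y.toRows₁ + Real.sin φ • Y.toRows₂)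
    (Real.cos φ • Y.toRows₂ - Real.sin φ • Y.toRows₁)

theorem cplus_rot {n : ℕ} (φ : ℝ) (Y : Matrix (Fin n ⊕ Fin n) (Fin n) ℝ) :
    cplus (rot φ Y) = Complex.exp (((-φ : ℝ) : ℂ) * Complex.I) • cplus Y := by
  ext i j
  simp only [cplus, rot, toRows₁_fromRows, toRows₂_fromRows, Complex.exp_mul_I,
    ← Complex.ofReal_cos, ← Complex.ofReal_sin, Real.cos_neg, Real.sin_neg]
  simp only [Matrix.add_apply, Matrix.smul_apply, Matrix.map_apply, Matrix.sub_apply, smul_eq_mul]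
  push_cast
  linear_combination Complex.sin φ * ((Y.toRows₂ i j : ℝ) : ℂ) * Complex.I_sq

theorem cminus_rot {n : ℕ} (φ : ℝ) (Y : Matrix (Fin n ⊕ Fin n) (Fin n) ℝ) :
    cminus (rot φ Y) = Complex.exp ((φ : ℂ) * Complex.I) • cminus Y := by
  ext i j
  simp only [cminus, rot, toRows₁_fromRows, toRows₂_fromRows, Complex.exp_mul_I,
    ← Complex.ofReal_cos, ← Complex.ofReal_sin]
  simp only [Matrix.add_apply, Matrix.smul_apply, Matrix.map_apply, Matrix.sub_apply, smul_eq_mul]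
  push_cast
  linear_combination Complex.sin φ * ((Y.toRows₂ i j : ℝ) : ℂ) * Complex.I_sq

theorem IsLagrangian.rot {n : ℕ} {Y : Matrix (Fin n ⊕ Fin n) (Fin n) ℝ} (hY : IsLagrangian Y)
    (φ : ℝ) : IsLagrangian (rot φ Y) := by
  have hcs := Real.sin_sq_add_cos_sq φ
  have hsymm := hY.symm
  have hg : (LagrangianMaslov.rot φ Y)ᵀ * LagrangianMaslov.rot φ Y = Yᵀ * Y := by
    rw [transpose_mul_self_eq, transpose_mul_self_eq, LagrangianMaslov.rot]
    simp only [toRows₁_fromRows, toRows₂_fromRows, transpose_add, transpose_sub, transpose_smul,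
      Matrix.add_mul, Matrix.sub_mul, Matrix.mul_add, Matrix.mul_sub, Matrix.smul_mul,
      Matrix.mul_smul]
    rw [← one_smul ℝ (Y.toRows₁ᵀ * Y.toRows₁ + Y.toRows₂ᵀ * Y.toRows₂), ← hcs]
    module
  constructor
  · change wronskian (LagrangianMaslov.rot φ Y) (LagrangianMaslov.rot φ Y) = 0
    rw [wronskian_eq, LagrangianMaslov.rot]
    simp only [toRows₁_fromRows, toRows₂_fromRows, transpose_add, transpose_sub, transpose_smul,
      Matrix.add_mul, Matrix.sub_mul, Matrix.mul_add, Matrix.mul_sub, Matrix.smul_mul,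
      Matrix.mul_smul, hsymm]
    module
  · rw [← rank_transpose_mul_self, hg, rank_transpose_mul_self, hY.2]

theorem gam_rot {n : ℕ} {Y : Matrix (Fin n ⊕ Fin n) (Fin n) ℝ} (hY : IsLagrangian Y) (φ : ℝ) :
    gam (rot φ Y) = Complex.exp (((-(2 * φ) : ℝ) : ℂ) * Complex.I) • gam Y := by
  refine gam_eq_of_mul_cminus (hY.rot φ) ?_
  rw [cminus_rot, cplus_rot, Matrix.smul_mul, Matrix.mul_smul, smul_smul, hY.gam_mul_cminus,
    ← Complex.exp_add]
  congr 2
  push_cast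
  ring

theorem relUnitary_rot {n : ℕ} (Y : Matrix (Fin n ⊕ Fin n) (Fin n) ℝ)
    {Yh : Matrix (Fin n ⊕ Fin n) (Fin n) ℝ} (hYh : IsLagrangian Yh) (φ : ℝ) :
    relUnitary Y (rot φ Yh) = Complex.exp (((2 * φ : ℝ) : ℂ) * Complex.I) • relUnitary Y Yh := by
  rw [relUnitary, gam_rot hYh, conjTranspose_smul, Matrix.mul_smul, relUnitary, Complex.star_def,
    ← Complex.exp_conj]
  congr 2
  simp only [map_mul, Complex.conj_ofReal, Complex.conj_I]
  push_cast
  ring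

/-- Both angle sums containing Ŷ grow by n·2φ for small φ ≥ 0 and enter with opposite signs. Only φ
≥ 0 is allowed, because the window [0, 2π) is closed on the left only. -/
theorem tripleAngle_rot {n : ℕ} {Y Yh : Matrix (Fin n ⊕ Fin n) (Fin n) ℝ} (hY : IsLagrangian Y)
    (hYh : IsLagrangian Yh) :
    ∃ φ₀ > (0 : ℝ), ∀ φ ∈ Set.Ico 0 φ₀, tripleAngle Y (rot φ Yh) = tripleAngle Y Yh := by
  obtain ⟨δ₁, hδ₁, h1⟩ := angSum_rotate (relUnitary_mem hY hYh)
  obtain ⟨δ₂, hδ₂, h2⟩ := angSum_rotate (relUnitary_mem (isLagrangian_vertical n) hYh)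
  refine ⟨min δ₁ δ₂ / 2, by positivity, fun φ hφ => ?_⟩
  have hlt : 2 * φ < min δ₁ δ₂ := by linarith [hφ.2]
  have h0 : 0 ≤ 2 * φ := by linarith [hφ.1]
  rw [tripleAngle, tripleAngle, relUnitary_rot _ hYh, relUnitary_rot _ hYh,
    h1 _ ⟨h0, hlt.trans_le (min_le_left _ _)⟩, h2 _ ⟨h0, hlt.trans_le (min_le_right _ _)⟩]
  ring

/-! ### The triple angle sum relative to the horizontal plane -/

/-- The horizontal Lagrangian plane. -/
def horizontal (n : ℕ) : Matrix (Fin n ⊕ Fin n) (Fin n) ℝ :=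
  Matrix.fromRows 1 0

theorem isLagrangian_horizontal (n : ℕ) : IsLagrangian (horizontal n) := by
  constructor
  · change wronskian (horizontal n) (horizontal n) = 0
    rw [wronskian_eq]
    simp [horizontal]
  · rw [← rank_transpose_mul_self, transpose_mul_self_eq]
    simp [horizontal]

theorem gam_horizontal (n : ℕ) : gam (horizontal n) = 1 := by
  refine gam_eq_of_mul_cminus (isLagrangian_horizontal n) ?_
  rw [Matrix.one_mul, cminus, cplus, horizontal]
  simp

theorem gam_vertical (n : ℕ) : gam (vertical n) = -1 := by
  refine gam_eq_of_mul_cminus (isLagrangian_vertical n) ?_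
  rw [Matrix.neg_mul, Matrix.one_mul, cminus, cplus, vertical]
  simp

/-- If z has angle θ, then -z̄ has angle π - θ, which must be raised by 2π exactly when θ > π, i.e.
when z lies in the lower half plane. -/
theorem ang_add_ang_neg_star {z : ℂ} (hz : ‖z‖ = 1) :
    ang 0 z + ang 0 (-star z) - Real.pi = 2 * Real.pi * (if z.im < 0 then 1 else 0) := by
  have hpi := Real.pi_pos
  have h := ang_mem 0 z
  rw [zero_add] at h
  have hexp := exp_ang 0 hz
  have him : z.im = Real.sin (ang 0 z) := by
    conv_lhs => rw [← hexp, Complex.exp_ofReal_mul_I_im]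
  have hz' : ‖-star z‖ = 1 := by rw [norm_neg, norm_star, hz]
  have hstar : -star z = Complex.exp (((Real.pi - ang 0 z : ℝ) : ℂ) * Complex.I) := by
    conv_lhs => rw [← hexp, Complex.star_def, ← Complex.exp_conj]
    push_cast
    rw [sub_mul, Complex.exp_sub, Complex.exp_pi_mul_I]
    simp [Complex.exp_neg, div_eq_mul_inv]
  rcases le_or_gt (ang 0 z) Real.pi with hle | hgt
  · have h1 : ¬ z.im < 0 := by
      rw [him, not_lt]; exact Real.sin_nonneg_of_nonneg_of_le_pi h.1 hle
    have h2 : ang 0 (-star z) = Real.pi - ang 0 z :=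
      (ang_eq_iff ⟨by linarith, by linarith [h.1]⟩ hz').mpr hstar
    rw [if_neg h1, h2]; ring
  · have h1 : z.im < 0 := by
      rw [him, ← Real.sin_sub_two_pi]
      exact Real.sin_neg_of_neg_of_neg_pi_lt (by linarith [h.2]) (by linarith)
    have h2 : ang 0 (-star z) = 3 * Real.pi - ang 0 z := by
      refine (ang_eq_iff ⟨by linarith [h.2], by linarith⟩ hz').mpr ?_
      rw [hstar, Complex.exp_eq_exp_iff_exists_int]
      exact ⟨-1, by push_cast; ring⟩
    rw [if_pos h1, h2]; ring

theorem conjTranspose_diagonalization {n : ℕ} (P : Matrix (Fin n) (Fin n) ℂ) (d : Fin n → ℂ) :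
    (P * diagonal d * Pᴴ)ᴴ = P * diagonal (star d) * Pᴴ := by
  simp [conjTranspose_mul, Matrix.mul_assoc, diagonal_conjTranspose]

/-- The three unitary matrices are G, -Gᴴ and -1 with G = `gam Y`, all diagonal in an eigenbasis of
G. The angle sum therefore counts eigenvalues with negative imaginary part, and (G - Gᴴ)/4i is
congruent to XᵀU. -/
theorem tripleAngle_horizontal {n : ℕ} {Y : Matrix (Fin n ⊕ Fin n) (Fin n) ℝ}
    (hY : IsLagrangian Y) :
    tripleAngle Y (horizontal n) = 2 * Real.pi * negIndex (Y.toRows₁ᵀ * Y.toRows₂) := by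
  have hpi := Real.pi_pos
  obtain ⟨P, hP, d, hd, hG⟩ := exists_unitary_diagonalization hY.gam_mem_unitaryGroup
  have h1 : relUnitary Y (horizontal n) = P * diagonal d * Pᴴ := by
    rw [relUnitary, gam_horizontal, conjTranspose_one, Matrix.mul_one, hG]
  have h2 : relUnitary (vertical n) Y = P * diagonal (fun i => -star (d i)) * Pᴴ := by
    rw [relUnitary, gam_vertical, hG, conjTranspose_diagonalization]
    have : (diagonal fun i => -star (d i)) = -diagonal (star d) := by
      rw [diagonal_neg]; rfl
    rw [this, Matrix.neg_mul, Matrix.one_mul, Matrix.mul_neg, Matrix.neg_mul]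
  have h3 : relUnitary (vertical n) (horizontal n) = P * diagonal (fun _ => (-1 : ℂ)) * Pᴴ := by
    rw [relUnitary, gam_vertical, gam_horizontal, conjTranspose_one, Matrix.mul_one,
      ← smul_one_eq_diagonal, Matrix.mul_smul, Matrix.smul_mul, Matrix.mul_one,
      mul_conjTranspose_self_of_mem_unitaryGroup hP, neg_one_smul]
  have hang : ang 0 (-1 : ℂ) = Real.pi := by
    rw [ang_eq_iff ⟨hpi.le, by linarith⟩ (by simp), Complex.exp_pi_mul_I]
  have hcong : (Y.toRows₁ᵀ * Y.toRows₂).map Complex.ofReal = (Pᴴ * cminus Y)ᴴ *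
      diagonal (fun i => (((d i).im / 2 : ℝ) : ℂ)) * (Pᴴ * cminus Y) := by
    have h4 : diagonal (fun i => (((d i).im / 2 : ℝ) : ℂ))
        = (4 * Complex.I)⁻¹ • (diagonal d - diagonal (star d)) := by
      rw [diagonal_sub, ← diagonal_smul]
      congr 1
      funext i
      have : d i - star (d i) = 2 * Complex.I * (d i).im := by
        rw [Complex.star_def, Complex.sub_conj]; push_cast; ring
      simp only [Pi.smul_apply, Pi.star_apply, smul_eq_mul]
      rw [this]
      push_cast
      field_simp [Complex.I_ne_zero]
      ring
    have h5 : (cminus Y)ᴴ * (gam Y - (gam Y)ᴴ) * cminus Y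
        = (4 * Complex.I) • (Y.toRows₁ᵀ * Y.toRows₂).map Complex.ofReal := by
      have h6 : (cminus Y)ᴴ * (gam Y)ᴴ = (cplus Y)ᴴ := by
        rw [← conjTranspose_mul, hY.gam_mul_cminus]
      rw [Matrix.mul_sub, Matrix.sub_mul, Matrix.mul_assoc _ (gam Y), hY.gam_mul_cminus, h6,
        cminus_conjTranspose, cplus_conjTranspose]
      have h7 : (Y.toRows₂ᵀ * Y.toRows₁).map Complex.ofReal
          = (Y.toRows₁ᵀ * Y.toRows₂).map Complex.ofReal := by rw [hY.symm]
      rw [map_ofReal_mul, map_ofReal_mul] at h7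
      rw [map_ofReal_mul]
      simp only [cplus, cminus, transpose_add, transpose_sub, transpose_smul, Matrix.add_mul,
        Matrix.sub_mul, Matrix.mul_add, Matrix.mul_sub, Matrix.smul_mul, Matrix.mul_smul,
        ← transpose_map, h7]
      module
    rw [h4, conjTranspose_mul, conjTranspose_conjTranspose, Matrix.mul_smul, Matrix.smul_mul]
    have h8 : (cminus Y)ᴴ * P * (diagonal d - diagonal (star d)) * (Pᴴ * cminus Y)
        = (cminus Y)ᴴ * (gam Y - (gam Y)ᴴ) * cminus Y := by
      rw [hG, conjTranspose_diagonalization, ← Matrix.sub_mul, ← Matrix.mul_sub]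
      simp only [Matrix.mul_assoc]
    rw [h8, h5, smul_smul, inv_mul_cancel₀, one_smul]
    exact mul_ne_zero (by norm_num) Complex.I_ne_zero
  have hS : IsUnit (Pᴴ * cminus Y) := by
    refine IsUnit.mul ?_ ((isUnit_iff_isUnit_det _).mpr hY.isUnit_det.1)
    exact ⟨⟨Pᴴ, P, conjTranspose_mul_self_of_mem_unitaryGroup hP,
      mul_conjTranspose_self_of_mem_unitaryGroup hP⟩, rfl⟩
  have hsymm : (Y.toRows₁ᵀ * Y.toRows₂)ᵀ = Y.toRows₁ᵀ * Y.toRows₂ := by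
    rw [transpose_mul, transpose_transpose, hY.symm]
  rw [negIndex_eq_of_complex_congruence hsymm hS hcong, tripleAngle, h1, h2, h3, angSum, angSum,
    angSum, eigSum_diagonalization _ hP, eigSum_diagonalization _ hP, eigSum_diagonalization _ hP,
    ← Finset.sum_add_distrib, ← Finset.sum_sub_distrib, hang,
    Finset.sum_congr rfl fun i _ => ang_add_ang_neg_star (hd i), ← Finset.mul_sum, Finset.sum_boole]
  congr 3
  ext i
  simp only [Finset.mem_filter, Finset.mem_univ, true_and]
  constructor <;> intro h <;> linarith

/-! ### The comparative index as a triple angle sum -/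

/-- The orthogonal projection onto the range. -/
def rangeProj {n : ℕ} (X : Matrix (Fin n) (Fin n) ℝ) : Matrix (Fin n) (Fin n) ℝ := X * pinv X

theorem rangeProj_transpose {n : ℕ} (X : Matrix (Fin n) (Fin n) ℝ) :
    (rangeProj X)ᵀ = rangeProj X := (pinv_spec X).symm_left

theorem rangeProj_mul_self {n : ℕ} (X : Matrix (Fin n) (Fin n) ℝ) : rangeProj X * X = X :=
  (pinv_spec X).mul_mul_left

theorem rangeProj_mul_rangeProj {n : ℕ} (X : Matrix (Fin n) (Fin n) ℝ) :
    rangeProj X * rangeProj X = rangeProj X := by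
  conv_lhs => rw [rangeProj, ← Matrix.mul_assoc, ← rangeProj, rangeProj_mul_self]
  rfl

theorem transpose_mul_rangeProj {n : ℕ} (X : Matrix (Fin n) (Fin n) ℝ) : Xᵀ * rangeProj X = Xᵀ := by
  have := congrArg transpose (rangeProj_mul_self X)
  rwa [transpose_mul, rangeProj_transpose] at this

/-- The symmetric slope of a Lagrangian plane over the range of its first component. -/
def slope {n : ℕ} (Y : Matrix (Fin n ⊕ Fin n) (Fin n) ℝ) : Matrix (Fin n) (Fin n) ℝ :=
  (pinv Y.toRows₁)ᵀ * (Y.toRows₁ᵀ * Y.toRows₂) * pinv Y.toRows₁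

theorem IsLagrangian.slope_transpose {n : ℕ} {Y : Matrix (Fin n ⊕ Fin n) (Fin n) ℝ}
    (hY : IsLagrangian Y) : (slope Y)ᵀ = slope Y := by
  rw [slope, transpose_mul, transpose_mul, transpose_mul, transpose_transpose, transpose_transpose,
    ← hY.symm]
  simp only [Matrix.mul_assoc]

theorem slope_eq {n : ℕ} (Y : Matrix (Fin n ⊕ Fin n) (Fin n) ℝ) :
    slope Y = rangeProj Y.toRows₁ * Y.toRows₂ * pinv Y.toRows₁ := by
  rw [slope, ← Matrix.mul_assoc, ← transpose_mul, ← rangeProj, rangeProj_transpose]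

/-- Thus the shear by the slope removes from U its component in the range of X. -/
theorem IsLagrangian.slope_mul {n : ℕ} {Y : Matrix (Fin n ⊕ Fin n) (Fin n) ℝ}
    (hY : IsLagrangian Y) : slope Y * Y.toRows₁ = rangeProj Y.toRows₁ * Y.toRows₂ := by
  calc slope Y * Y.toRows₁
      = (pinv Y.toRows₁)ᵀ * Y.toRows₂ᵀ * (Y.toRows₁ * pinv Y.toRows₁ * Y.toRows₁) := by
        rw [slope, hY.symm]; simp only [Matrix.mul_assoc]
    _ = (pinv Y.toRows₁)ᵀ * (Y.toRows₁ᵀ * Y.toRows₂) := by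
        rw [(pinv_spec _).mul_mul_left, hY.symm, Matrix.mul_assoc]
    _ = (Y.toRows₁ * pinv Y.toRows₁)ᵀ * Y.toRows₂ := by
        rw [transpose_mul, Matrix.mul_assoc]
    _ = _ := by rw [(pinv_spec _).symm_left]; rfl

/-- The frame `X + (I - X X†) U`, which is invertible for a Lagrangian plane. -/
def splitFrame {n : ℕ} (Y : Matrix (Fin n ⊕ Fin n) (Fin n) ℝ) : Matrix (Fin n) (Fin n) ℝ :=
  Y.toRows₁ + (1 - rangeProj Y.toRows₁) * Y.toRows₂

/-- The coordinate Lagrangian plane of an orthogonal projection. -/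
def projPlane {n : ℕ} (Pr : Matrix (Fin n) (Fin n) ℝ) : Matrix (Fin n ⊕ Fin n) (Fin n) ℝ :=
  fromRows Pr (1 - Pr)

/-- After the shear the components are X, in the range of the projection, and (1 - XX†)U, in its
orthogonal complement; both are read off from their sum `splitFrame Y`. -/
theorem IsLagrangian.shear_slope {n : ℕ} {Y : Matrix (Fin n ⊕ Fin n) (Fin n) ℝ}
    (hY : IsLagrangian Y) :
    LagrangianMaslov.shear (slope Y) Y = projPlane (rangeProj Y.toRows₁) * splitFrame Y := by
  have hP := rangeProj_mul_rangeProj Y.toRows₁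
  have hX := rangeProj_mul_self Y.toRows₁
  rw [shear_eq, hY.slope_mul, projPlane, fromRows_mul]
  congr 1
  · rw [splitFrame, Matrix.mul_add, ← Matrix.mul_assoc, Matrix.mul_sub, hP, hX, Matrix.mul_one,
      sub_self, Matrix.zero_mul, add_zero]
  · rw [splitFrame]
    simp only [Matrix.mul_add, Matrix.sub_mul, Matrix.mul_sub, Matrix.one_mul, ← Matrix.mul_assoc,
      hP, hX]
    abel

theorem IsLagrangian.splitFrame_isUnit {n : ℕ} {Y : Matrix (Fin n ⊕ Fin n) (Fin n) ℝ}
    (hY : IsLagrangian Y) :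
    IsUnit (splitFrame Y) ∧ IsLagrangian (projPlane (rangeProj Y.toRows₁)) := by
  have h := hY.shear hY.slope_transpose
  rw [hY.shear_slope] at h
  exact h.of_mul_right

/-- The moves are: shear by the slope of Ŷ, replacement by the coordinate plane, rotation by φ =
arctan t, and a shear by T that turns the rotated plane, a graph, into the horizontal plane. The
terms in t and t⁻¹ are the two blocks of T. -/
theorem tripleAngle_eq_negIndex {n : ℕ} {Y Yh : Matrix (Fin n ⊕ Fin n) (Fin n) ℝ}
    (hY : IsLagrangian Y) (hYh : IsLagrangian Yh) :
    ∃ t₀ > (0 : ℝ), ∀ t ∈ Set.Ioo 0 t₀, tripleAngle Y Yh = 2 * Real.pi *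
      negIndex (Y.toRows₁ᵀ * (Y.toRows₂ - slope Yh * Y.toRows₁)
        + t • (Y.toRows₁ᵀ * rangeProj Yh.toRows₁ * Y.toRows₁)
        - t⁻¹ • (Y.toRows₁ᵀ * (1 - rangeProj Yh.toRows₁) * Y.toRows₁)) := by
  set Q := slope Yh
  have hQ : Qᵀ = Q := hYh.slope_transpose
  set Pr := rangeProj Yh.toRows₁ with hPr
  have hPrPr : Pr * Pr = Pr := rangeProj_mul_rangeProj _
  have hPrt : Prᵀ = Pr := rangeProj_transpose _
  have hD : IsLagrangian (projPlane Pr) := hYh.splitFrame_isUnit.2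
  have hY' : IsLagrangian (shear Q Y) := hY.shear hQ
  obtain ⟨φ₀, hφ₀, hrot⟩ := tripleAngle_rot hY' hD
  refine ⟨φ₀, hφ₀, fun t ht => ?_⟩
  have ht0 : t ≠ 0 := ht.1.ne'
  -- As t = tan φ > φ, the bound t < φ₀ makes the rotation admissible; the slopes of the rotated
  -- plane are -t on the range of `Pr` and t⁻¹ on its complement.
  set φ := Real.arctan t with hφ
  have hφ0 : 0 ≤ φ := Real.arctan_nonneg.mpr ht.1.le
  have hφlt : φ < φ₀ := by
    have h := Real.lt_tan (Real.arctan_pos.mpr ht.1) (Real.arctan_lt_pi_div_two t)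
    rw [Real.tan_arctan] at h
    exact h.trans ht.2
  have hcos : 0 < Real.cos φ := Real.cos_arctan_pos t
  have hsin : Real.sin φ = t * Real.cos φ := by
    rw [← Real.tan_mul_cos hcos.ne', hφ, Real.tan_arctan]
  set T : Matrix (Fin n) (Fin n) ℝ := t⁻¹ • (1 - Pr) - t • Pr with hT
  have hTt : Tᵀ = T := by simp [hT, hPrt]
  set L : Matrix (Fin n) (Fin n) ℝ := Real.cos φ • Pr + Real.sin φ • (1 - Pr) with hL
  -- The rotated plane is the graph of `T`.
  have hgraph : rot φ (projPlane Pr) = shear (-T) (horizontal n) * L := by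
    have hTL : T * L = Real.cos φ • (1 - Pr) - Real.sin φ • Pr := by
      rw [hT, hL, hsin]
      simp only [Matrix.mul_add, Matrix.sub_mul, Matrix.smul_mul, Matrix.mul_smul, Matrix.mul_sub,
        Matrix.mul_one, Matrix.one_mul, hPrPr]
      have h1 : t⁻¹ * (t * Real.cos φ) = Real.cos φ := by field_simp
      ext i j
      simp only [Matrix.add_apply, Matrix.sub_apply, Matrix.smul_apply, smul_eq_mul]
      linear_combination ((1 : Matrix (Fin n) (Fin n) ℝ) i j - Pr i j) * h1
    rw [rot, shear_eq, horizontal, fromRows_mul]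
    simp only [projPlane, toRows₁_fromRows, toRows₂_fromRows, Matrix.mul_one, Matrix.one_mul,
      zero_sub, neg_neg, hTL, ← hL]
  have hTt' : (-T)ᵀ = -T := by rw [transpose_neg, hTt]
  have hH : IsLagrangian (shear (-T) (horizontal n)) := (isLagrangian_horizontal n).shear hTt'
  have hback : ∀ Z : Matrix (Fin n ⊕ Fin n) (Fin n) ℝ, shear T (shear (-T) Z) = Z := by
    intro Z
    rw [shear_eq, shear_eq]
    simp only [toRows₁_fromRows, toRows₂_fromRows, Matrix.neg_mul, sub_neg_eq_add,
      add_sub_cancel_right, fromRows_toRows]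
  calc tripleAngle Y Yh = tripleAngle (shear Q Y) (shear Q Yh) := (tripleAngle_shear hQ hY hYh).symm
    _ = tripleAngle (shear Q Y) (projPlane Pr) := by
        refine tripleAngle_congr rfl ?_
        rw [hYh.shear_slope]
        refine gam_mul_right hD ?_
        rw [← hYh.shear_slope]
        exact hYh.shear hQ
    _ = tripleAngle (shear Q Y) (rot φ (projPlane Pr)) := (hrot φ ⟨hφ0, hφlt⟩).symm
    _ = tripleAngle (shear Q Y) (shear (-T) (horizontal n)) := by
        refine tripleAngle_congr rfl ?_
        rw [hgraph]
        refine gam_mul_right hH ?_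
        rw [← hgraph]
        exact hD.rot φ
    _ = tripleAngle (shear T (shear Q Y)) (horizontal n) := by
        rw [← tripleAngle_shear hTt hY' hH, hback]
    _ = _ := by
        rw [tripleAngle_horizontal (hY'.shear hTt)]
        congr 3
        rw [shear_eq, shear_eq]
        simp only [toRows₁_fromRows, toRows₂_fromRows, hT]
        simp only [Matrix.mul_sub, Matrix.sub_mul, Matrix.smul_mul, Matrix.mul_smul,
          Matrix.mul_assoc]
        abel

/-! ### The matrices ℳ, V, 𝒫 in terms of the projection onto the range of X̂ -/

theorem compV_transpose {n : ℕ} (Y Yh : Matrix (Fin n ⊕ Fin n) (Fin n) ℝ) :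
    (compV Y Yh)ᵀ = compV Y Yh := by
  rw [compV, transpose_sub, transpose_one, (pinv_spec _).symm_right]

theorem compM_mul_compV {n : ℕ} (Y Yh : Matrix (Fin n ⊕ Fin n) (Fin n) ℝ) :
    compM Y Yh * compV Y Yh = 0 := by
  rw [compV, Matrix.mul_sub, Matrix.mul_one, ← Matrix.mul_assoc, (pinv_spec _).mul_mul_left,
    sub_self]

theorem one_sub_pinv_mul_transpose {n : ℕ} (X : Matrix (Fin n) (Fin n) ℝ) :
    (1 - pinv X * X) * Xᵀ = 0 := by
  have h : X * (1 - pinv X * X) = 0 := by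
    rw [Matrix.mul_sub, Matrix.mul_one, ← Matrix.mul_assoc, (pinv_spec X).mul_mul_left, sub_self]
  have h' := congrArg transpose h
  rwa [transpose_mul, transpose_sub, transpose_one, (pinv_spec X).symm_right, transpose_zero] at h'

theorem splitFrame_transpose_mul {n : ℕ} (Y : Matrix (Fin n ⊕ Fin n) (Fin n) ℝ) :
    (splitFrame Y)ᵀ * (1 - rangeProj Y.toRows₁) = Y.toRows₂ᵀ * (1 - rangeProj Y.toRows₁) := by
  have hP := rangeProj_mul_rangeProj Y.toRows₁
  rw [splitFrame, transpose_add, transpose_mul, transpose_sub, transpose_one, rangeProj_transpose,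
    Matrix.add_mul, Matrix.mul_assoc, Matrix.mul_sub, transpose_mul_rangeProj, Matrix.mul_one,
    sub_self, zero_add]
  congr 1
  simp [Matrix.sub_mul, Matrix.mul_sub, hP]

theorem splitFrame_transpose_mul_rangeProj {n : ℕ} (Y : Matrix (Fin n ⊕ Fin n) (Fin n) ℝ) :
    (splitFrame Y)ᵀ * rangeProj Y.toRows₁ = Y.toRows₁ᵀ := by
  have hP := rangeProj_mul_rangeProj Y.toRows₁
  rw [splitFrame, transpose_add, transpose_mul, transpose_sub, transpose_one, rangeProj_transpose,
    Matrix.add_mul, Matrix.mul_assoc, transpose_mul_rangeProj, Matrix.sub_mul, hP, Matrix.one_mul,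
    sub_self, Matrix.mul_zero, add_zero]

/-- The matrix `ℳ` in terms of the invertible frame. -/
theorem compM_eq {n : ℕ} {Yh : Matrix (Fin n ⊕ Fin n) (Fin n) ℝ} (hYh : IsLagrangian Yh)
    (Y : Matrix (Fin n ⊕ Fin n) (Fin n) ℝ) :
    compM Yh Y = -((1 - pinv Yh.toRows₁ * Yh.toRows₁) * (splitFrame Yh)ᵀ *
      ((1 - rangeProj Yh.toRows₁) * Y.toRows₁)) := by
  have h1 := one_sub_pinv_mul_transpose Yh.toRows₁
  -- Isotropy turns ÛᵀX̂ into X̂ᵀÛ, whose columns lie in the range of X̂ᵀ, which 1 - X̂†X̂ kills.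
  have h2 : (1 - pinv Yh.toRows₁ * Yh.toRows₁) * (Yh.toRows₂ᵀ * rangeProj Yh.toRows₁) = 0 := by
    rw [rangeProj, ← Matrix.mul_assoc Yh.toRows₂ᵀ, ← hYh.symm, ← Matrix.mul_assoc,
      ← Matrix.mul_assoc, h1, Matrix.zero_mul, Matrix.zero_mul]
  have h3 : (1 - pinv Yh.toRows₁ * Yh.toRows₁) * (Yh.toRows₂ᵀ * (1 - rangeProj Yh.toRows₁))
      = (1 - pinv Yh.toRows₁ * Yh.toRows₁) * Yh.toRows₂ᵀ := by
    rw [Matrix.mul_sub Yh.toRows₂ᵀ, Matrix.mul_sub _ (Yh.toRows₂ᵀ * 1), h2, Matrix.mul_one, sub_zero]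
  rw [compM, wronskian_eq, Matrix.mul_sub, ← Matrix.mul_assoc, h1, Matrix.zero_mul, zero_sub,
    ← Matrix.mul_assoc _ (1 - rangeProj Yh.toRows₁), Matrix.mul_assoc _ (splitFrame Yh)ᵀ,
    splitFrame_transpose_mul, h3, Matrix.mul_assoc]

/-- With y = (1 - X̂X̂†)Xx and K the split frame, ℳx = 0 puts Kᵀy in the range of X̂ᵀ = KᵀX̂X̂†.
Since Kᵀ is injective, y lies in the range of X̂, to which it is also orthogonal, so y = 0. -/
theorem compM_mulVec_eq_zero_iff {n : ℕ} {Yh : Matrix (Fin n ⊕ Fin n) (Fin n) ℝ}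
    (hYh : IsLagrangian Yh) (Y : Matrix (Fin n ⊕ Fin n) (Fin n) ℝ) (x : Fin n → ℝ) :
    compM Yh Y *ᵥ x = 0 ↔ ((1 - rangeProj Yh.toRows₁) * Y.toRows₁) *ᵥ x = 0 := by
  rw [compM_eq hYh, neg_mulVec, neg_eq_zero]
  constructor
  · intro h
    set Pr := rangeProj Yh.toRows₁ with hPr
    set y := ((1 - Pr) * Y.toRows₁) *ᵥ x with hy
    set K := splitFrame Yh with hK
    have hPry : Pr *ᵥ y = 0 := by
      rw [hy, mulVec_mulVec, ← Matrix.mul_assoc, Matrix.mul_sub, Matrix.mul_one,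
        rangeProj_mul_rangeProj, sub_self, Matrix.zero_mul, zero_mulVec]
    have h1 : Kᵀ *ᵥ y = Kᵀ *ᵥ (Pr *ᵥ ((pinv Yh.toRows₁)ᵀ *ᵥ (Kᵀ *ᵥ y))) := by
      rw [← mulVec_mulVec, ← mulVec_mulVec, ← hy, sub_mulVec, one_mulVec, sub_eq_zero] at h
      conv_lhs => rw [h]
      rw [mulVec_mulVec _ Kᵀ Pr, splitFrame_transpose_mul_rangeProj, mulVec_mulVec _ Yh.toRows₁ᵀ,
        ← transpose_mul, (pinv_spec _).symm_right]
    have hKu : IsUnit Kᵀ := by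
      rw [isUnit_iff_isUnit_det, det_transpose, ← isUnit_iff_isUnit_det]
      exact hYh.splitFrame_isUnit.1
    have h2 := mulVec_injective_iff_isUnit.mpr hKu h1
    rw [h2, mulVec_mulVec, rangeProj_mul_rangeProj, ← h2] at hPry
    exact hPry
  · intro h
    rw [← mulVec_mulVec, h, mulVec_zero]

theorem rank_eq_of_mulVec_eq_zero_iff {n : ℕ} {A B : Matrix (Fin n) (Fin n) ℝ}
    (h : ∀ x, A *ᵥ x = 0 ↔ B *ᵥ x = 0) : A.rank = B.rank := by
  have hker : LinearMap.ker A.mulVecLin = LinearMap.ker B.mulVecLin := by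
    ext x
    simpa [LinearMap.mem_ker] using h x
  have h1 := LinearMap.finrank_range_add_finrank_ker A.mulVecLin
  have h2 := LinearMap.finrank_range_add_finrank_ker B.mulVecLin
  rw [hker] at h1
  rw [Matrix.rank, Matrix.rank]
  omega

/-- The comparative index is the angle sum of the triple `(E, Y, Ŷ)`, in units of `2π`. -/
theorem tripleAngle_eq_compIndex {n : ℕ} {Y Yh : Matrix (Fin n ⊕ Fin n) (Fin n) ℝ}
    (hY : IsLagrangian Y) (hYh : IsLagrangian Yh) :
    tripleAngle Y Yh = 2 * Real.pi * compIndex Yh Y := by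
  obtain ⟨t₁, ht₁, h1⟩ := tripleAngle_eq_negIndex hY hYh
  set Pr := rangeProj Yh.toRows₁ with hPr
  have hPrPr : Pr * Pr = Pr := rangeProj_mul_rangeProj _
  have hPrt : Prᵀ = Pr := rangeProj_transpose _
  have hQt : (slope Yh)ᵀ = slope Yh := hYh.slope_transpose
  set X := Y.toRows₁ with hX
  set A := Xᵀ * (Y.toRows₂ - slope Yh * X) with hA
  have hB : Xᵀ * (1 - Pr) * X = ((1 - Pr) * X)ᵀ * ((1 - Pr) * X) := by
    have : (1 - Pr) * (1 - Pr) = 1 - Pr := by simp [Matrix.sub_mul, Matrix.mul_sub, hPrPr]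
    rw [transpose_mul, transpose_sub, transpose_one, hPrt, Matrix.mul_assoc Xᵀ, Matrix.mul_assoc Xᵀ,
      ← Matrix.mul_assoc (1 - Pr) (1 - Pr), this]
  have hC : Xᵀ * Pr * X = (Pr * X)ᵀ * (Pr * X) := by
    rw [transpose_mul, hPrt, Matrix.mul_assoc Xᵀ, Matrix.mul_assoc Xᵀ, ← Matrix.mul_assoc Pr Pr, hPrPr]
  have hform : ∀ (M : Matrix (Fin n) (Fin n) ℝ) (x : Fin n → ℝ),
      x ⬝ᵥ (Mᵀ * M) *ᵥ x = (M *ᵥ x) ⬝ᵥ (M *ᵥ x) := by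
    intro M x
    rw [← mulVec_mulVec, dotProduct_mulVec, vecMul_transpose]
  have hpos : ∀ (M : Matrix (Fin n) (Fin n) ℝ) (x : Fin n → ℝ), 0 ≤ x ⬝ᵥ (Mᵀ * M) *ᵥ x := by
    intro M x
    rw [hform]
    exact Finset.sum_nonneg fun i _ => mul_self_nonneg _
  have hker : ∀ x, (Xᵀ * (1 - Pr) * X) *ᵥ x = 0 ↔ compM Yh Y *ᵥ x = 0 := by
    intro x
    rw [compM_mulVec_eq_zero_iff hYh, hB]
    constructor
    · intro h
      have h2 := hform ((1 - Pr) * X) x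
      rw [h, dotProduct_zero] at h2
      exact dotProduct_self_eq_zero.mp h2.symm
    · intro h
      rw [← mulVec_mulVec]
      exact (congrArg _ h).trans (mulVec_zero _)
  set V := compV Yh Y with hV
  have hVfix : ∀ x, compM Yh Y *ᵥ x = 0 → V *ᵥ x = x := by
    intro x hx
    rw [hV, compV, sub_mulVec, one_mulVec, ← mulVec_mulVec, hx, mulVec_zero, sub_zero]
  have hMV : compM Yh Y * V = 0 := compM_mul_compV Yh Y
  have hBV0 : ∀ M : Matrix (Fin n) (Fin n) ℝ, (∀ x, compM Yh Y *ᵥ x = 0 → M *ᵥ x = 0) →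
      M * V = 0 := by
    intro M hM
    refine ext_of_mulVec_single fun i => ?_
    rw [← mulVec_mulVec, zero_mulVec]
    refine hM _ ?_
    rw [mulVec_mulVec, hMV, zero_mulVec]
  -- On ker ℳ, the range of V, the vectors Xx lie in the range of X̂; this lets X̂X̂† be inserted or
  -- deleted next to X V.
  have hXV : Pr * X * V = X * V := by
    have := hBV0 ((1 - Pr) * X) fun x hx => (compM_mulVec_eq_zero_iff hYh Y x).mp hx
    rw [Matrix.sub_mul, Matrix.one_mul, Matrix.sub_mul, sub_eq_zero] at this
    exact this.symm
  have hVt : Vᵀ = V := compV_transpose Yh Y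
  have hVX : V * Xᵀ * Pr = V * Xᵀ := by
    have := congrArg transpose hXV
    rwa [transpose_mul, transpose_mul, transpose_mul, hVt, hPrt, ← Matrix.mul_assoc] at this
  have hAt : Aᵀ = A := by
    rw [hA, transpose_mul, transpose_sub, transpose_mul, transpose_transpose, hQt, Matrix.sub_mul,
      Matrix.mul_sub, hY.symm, Matrix.mul_assoc]
  -- Expanding the Wronskian gives two terms: X̂X̂† acts as the identity on X V in the first, and in
  -- the second ÛX̂† becomes the slope of Ŷ once VXᵀ stands to its left.
  have hP : compP Yh Y = V * A * V := by
    have e1 : X * V = Yh.toRows₁ * (pinv Yh.toRows₁ * (X * V)) := by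
      conv_lhs => rw [← hXV, hPr, rangeProj]
      simp only [Matrix.mul_assoc]
    have e2 : V * Xᵀ * slope Yh = V * Xᵀ * Yh.toRows₂ * pinv Yh.toRows₁ := by
      rw [slope_eq, ← Matrix.mul_assoc, ← Matrix.mul_assoc, hVX]
    calc compP Yh Y
        = V * (Y.toRows₂ᵀ * (Yh.toRows₁ * (pinv Yh.toRows₁ * (X * V))))
          - V * Xᵀ * Yh.toRows₂ * pinv Yh.toRows₁ * (X * V) := by
          rw [compP, wronskian_eq, transpose_sub, transpose_mul, transpose_mul,
            transpose_transpose, transpose_transpose]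
          simp only [Matrix.mul_sub, Matrix.sub_mul, Matrix.mul_assoc, hV, hX]
      _ = V * A * V := by
          rw [← e1, ← e2, hA, Matrix.mul_sub, Matrix.mul_sub, Matrix.sub_mul, hX, hY.symm]
          simp only [Matrix.mul_assoc]
  obtain ⟨t₂, ht₂, h2⟩ := negIndex_pencil (A := A) (B := Xᵀ * (1 - Pr) * X) (C := Xᵀ * Pr * X)
    (V := V) hAt (by rw [hB, transpose_mul, transpose_transpose])
    (by rw [hC, transpose_mul, transpose_transpose]) (by rw [hB]; exact hpos _)
    (fun x hx => by
      rw [hB, hform] at hx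
      rw [hker, compM_mulVec_eq_zero_iff hYh]
      exact dotProduct_self_eq_zero.mp hx)
    (by rw [hC]; exact hpos _) hVt (hBV0 _ fun x hx => (hker x).mpr hx)
    (fun x hx => hVfix x ((hker x).mp hx))
  have ht : min t₁ t₂ / 2 ∈ Set.Ioo 0 (min t₁ t₂) := by
    have : 0 < min t₁ t₂ := lt_min ht₁ ht₂
    exact ⟨by linarith, by linarith⟩
  rw [h1 _ ⟨ht.1, ht.2.trans_le (min_le_left _ _)⟩, h2 _ ⟨ht.1, ht.2.trans_le (min_le_right _ _)⟩,
    compIndex, hP, rank_eq_of_mulVec_eq_zero_iff hker]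

theorem compIndex_self {n : ℕ} {Y : Matrix (Fin n ⊕ Fin n) (Fin n) ℝ} (hY : IsLagrangian Y) :
    compIndex Y Y = 0 := by
  rw [compIndex, compP, compM, hY.wronskian_self, negIndex]
  simp

end

end LagrangianMaslov

/-! ### The comparison formula -/

theorem corollaryC (n : ℕ) (a b : ℝ) (hab : a < b)
    (Y Yh : ℝ → Matrix (Fin n ⊕ Fin n) (Fin n) ℝ)
    (hY : LagrangianMaslov.IsLagrangianPath a b Y)
    (hYh : LagrangianMaslov.IsLagrangianPath a b Yh) :
    (LagrangianMaslov.MaslovWellDefined a b Y Yh ∧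
      LagrangianMaslov.MaslovWellDefined a b (fun _ => LagrangianMaslov.vertical n) Yh ∧
      LagrangianMaslov.MaslovWellDefined a b (fun _ => LagrangianMaslov.vertical n) Y) ∧
    LagrangianMaslov.maslovIndex a b Y Yh =
      LagrangianMaslov.maslovIndex a b (fun _ => LagrangianMaslov.vertical n) Yh
        - LagrangianMaslov.maslovIndex a b (fun _ => LagrangianMaslov.vertical n) Y
        + (LagrangianMaslov.compIndex (Yh a) (Y a) : ℤ)
        - (LagrangianMaslov.compIndex (Yh b) (Y b) : ℤ) ∧
    (Y a = Yh a → Y b = Yh b →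
      LagrangianMaslov.maslovIndex a b Y Yh =
        LagrangianMaslov.maslovIndex a b (fun _ => LagrangianMaslov.vertical n) Yh
          - LagrangianMaslov.maslovIndex a b (fun _ => LagrangianMaslov.vertical n) Y) := by
  have hE : LagrangianMaslov.IsLagrangianPath a b (fun _ => LagrangianMaslov.vertical n) :=
    ⟨continuousOn_const, fun _ _ => LagrangianMaslov.isLagrangian_vertical n⟩
  have ha : a ∈ Set.Icc a b := ⟨le_rfl, hab.le⟩
  have hb : b ∈ Set.Icc a b := ⟨hab.le, le_rfl⟩
  obtain ⟨α, hα, hαe⟩ := LagrangianMaslov.exists_lift_det_gam hab hY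
  obtain ⟨β, hβ, hβe⟩ := LagrangianMaslov.exists_lift_det_gam hab hYh
  obtain ⟨η, hη, hηe⟩ := LagrangianMaslov.exists_lift_det_gam hab hE
  -- The path E is constant, so its determinant is too. The increments of η cancel in the final
  -- combination in any case.
  have hconst : η a = η b := LagrangianMaslov.eq_of_exp_eq_of_continuousOn hab.le hη hηe
  have h1 := LagrangianMaslov.two_pi_mul_maslovIndex hab hY hYh (hα.sub hβ)
    fun t ht => LagrangianMaslov.exp_lift_relUnitary (hαe t ht) (hβe t ht)
  have h2 := LagrangianMaslov.two_pi_mul_maslovIndex hab hE hYh (hη.sub hβ)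
    fun t ht => LagrangianMaslov.exp_lift_relUnitary (hηe t ht) (hβe t ht)
  have h3 := LagrangianMaslov.two_pi_mul_maslovIndex hab hE hY (hη.sub hα)
    fun t ht => LagrangianMaslov.exp_lift_relUnitary (hηe t ht) (hαe t ht)
  have h4 := LagrangianMaslov.tripleAngle_eq_compIndex (hY.2 a ha) (hYh.2 a ha)
  have h5 := LagrangianMaslov.tripleAngle_eq_compIndex (hY.2 b hb) (hYh.2 b hb)
  rw [LagrangianMaslov.tripleAngle] at h4 h5
  simp only [Pi.sub_apply] at h1 h2 h3
  have key : LagrangianMaslov.maslovIndex a b Y Yh =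
      LagrangianMaslov.maslovIndex a b (fun _ => LagrangianMaslov.vertical n) Yh
        - LagrangianMaslov.maslovIndex a b (fun _ => LagrangianMaslov.vertical n) Y
        + (LagrangianMaslov.compIndex (Yh a) (Y a) : ℤ)
        - (LagrangianMaslov.compIndex (Yh b) (Y b) : ℤ) := by
    have h6 : 2 * Real.pi * (LagrangianMaslov.maslovIndex a b Y Yh : ℝ) = 2 * Real.pi *
        ((LagrangianMaslov.maslovIndex a b (fun _ => LagrangianMaslov.vertical n) Yh : ℝ)
        - (LagrangianMaslov.maslovIndex a b (fun _ => LagrangianMaslov.vertical n) Y : ℝ)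
        + (LagrangianMaslov.compIndex (Yh a) (Y a) : ℝ)
        - (LagrangianMaslov.compIndex (Yh b) (Y b) : ℝ)) := by
      -- The lifts cancel, (α - β) - (η - β) + (η - α) = 0, leaving the triple angle sums at a and
      -- b.
      linear_combination h1 - h2 + h3 + h4 - h5
    exact_mod_cast mul_left_cancel₀ Real.two_pi_pos.ne' h6
  refine ⟨⟨LagrangianMaslov.maslovWellDefined_of_isLagrangianPath hab hY hYh,
    LagrangianMaslov.maslovWellDefined_of_isLagrangianPath hab hE hYh,
    LagrangianMaslov.maslovWellDefined_of_isLagrangianPath hab hE hY⟩, key, fun hYa hYb => ?_⟩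
  rw [key, hYa, hYb, LagrangianMaslov.compIndex_self (hYh.2 a ha),
    LagrangianMaslov.compIndex_self (hYh.2 b hb)]
  simp
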